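/- Let $X_1,X_2,\dots$ be i.i.d. copies of a real random variable $X$ with $E[X^4]<\infty$, mean $\mu$ and variance $\sigma^2>0$. Let $F_X$ be its distribution function, $Y=(X-\mu)/\sigma$ with distribution function $F_Y$, and for $p\in(0,1)$ let $q_X(p)=\inf\{x: F_X(x)\ge p\}$ and $q_Y(p)=\inf\{y:F_Y(y)\ge p\}$. For a sample of size $n$ put $$\bar X_n=\frac1n\sum_{j=1}^n X_j,\quad \hat\sigma_n^2=\frac1{n-1}\sum_{j=1}^n(X_j-\bar X_n)^2,\quad \hat\theta_n=\frac1n\sum_{j=1}^n|X_j-\bar X_n|,\quad \hat q_n(p)=\bar X_n+\hat\sigma_n\,q_Y(p).$$ Let $r\in\{1,2\}$; for $r=2$ let $\hat D_{2,n}=\hat\sigma_n^2$ and $D_2=\sigma^2$, for $r=1$ let $\hat D_{1,n}=\hat\theta_n$ and $D_1=E|X-\mu|$. If $r=1$, assume that $F_X$ is continuous at $\mu$. Let $h_1,h_2:\mathbb R\to\mathbb R$ be Borel measurable (for instance continuous), with $h_1$ differentiable at $q_X(p)$ and $h_2$ differentiable at $D_r$. Then $$\sqrt n\begin{pmatrix}h_1(\hat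 q_n(p))-h_1(q_X(p))\\ h_2(\hat D_{r,n})-h_2(D_r)\end{pmatrix}\xrightarrow{\ d\ }\mathcal N(0,\Lambda^{(r)}),$$ where $\Lambda^{(r)}$ is the symmetric positive semidefinite $2\times2$ matrix with entries $$\Lambda^{(r)}_{11}=\sigma^2\,h_1'(q_X(p))^2\,A,\qquad A=1+q_Y(p)\Big(q_Y(p)\frac{E[Y^4]-1}{4}+E[Y^3]\Big),$$ $$\Lambda^{(r)}_{22}=h_2'(D_r)^2\,\mathrm{Var}\big(|X-\mu|^r+(2-r)(2F_X(\mu)-1)X\big),\qquad \Lambda^{(r)}_{12}=\Lambda^{(r)}_{21}=\sigma^{r+1}h_1'(q_X(p))\,h_2'(D_r)\,B_r,$$ $$B_r=E[Y^{r+1}]+(2-r)\Big(2F_Y(0)-1-2E\big[|Y|^{r+1}\mathbf 1_{\{Y<0\}}\big]\Big)+\frac{q_Y(p)}2\Big(E|Y|^{r+2}-E|Y|^r+(2-r)(2F_Y(0)-1)E[Y^3]\Big).$$ Suppose moreover that $\Lambda^{(r)}_{11}>0$ and $\Lambda^{(r)}_{22}>0$, and put $$\rho=\mathrm{sgn}\big(h_1'(q_X(p))\,h_2'(D_r)\big)\,\frac{B_r}{\sqrt{A\;\mathrm{Var}\big(|Y|^r+(2-r)(2F_Y(0)-1)Y\big)}}.$$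 Then the asymptotic correlation, that is, the correlation of the two coordinates of the limit law $\mathcal N(0,\Lambda^{(r)})$, equals $\rho$, so that it does not depend on $h_1,h_2$ up to its sign. Also $$\lim_{n\to\infty}\mathrm{Cor}\big(h_1(\hat q_n(p)),h_2(\hat D_{r,n})\big)=\rho$$ whenever the two sequences $n\,(h_1(\hat q_n(p))-h_1(q_X(p)))^2$ and $n\,(h_2(\hat D_{r,n})-h_2(D_r))^2$ are uniformly integrable for $n$ large enough. Finally, irrespective of the positivity assumption, the first (respectively second) of these sequences is uniformly integrable as soon as $|h_1(x)|\le C(1+|x|)$ (respectively $|h_2(x)|\le C(1+|x|)$) for all $x$ and some constant $C$, in particular when $h_1$ (respectively $h_2$) is the identity. -/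

import Mathlib

open MeasureTheory ProbabilityTheory Filter Topology

noncomputable section

/-! ### Estimators: `x 0, …, x (n - 1)` is the observed sample of size `n` -/

/-- Sample mean. -/
def sampleMean (n : ℕ) (x : ℕ → ℝ) : ℝ :=
  (∑ j ∈ Finset.range n, x j) / n

/-- Sample variance with normalisation `1 / (n - 1)`. -/
def sampleVariance (n : ℕ) (x : ℕ → ℝ) : ℝ :=
  (∑ j ∈ Finset.range n, (x j - sampleMean n x) ^ 2) / ((n : ℝ) - 1)

/-- Sample mean absolute deviation around the sample mean. -/
def sampleMAD (n : ℕ) (x : ℕ → ℝ) : ℝ :=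
  (∑ j ∈ Finset.range n, |x j - sampleMean n x|) / n

/-- Sample measure of dispersion: the sample variance if `r = 2`, the sample MAD if `r = 1`. -/
def sampleDispersion (r n : ℕ) (x : ℕ → ℝ) : ℝ :=
  if r = 2 then sampleVariance n x else sampleMAD n x

/-- Location-scale quantile estimator built with the quantile `qY` of the standardised law. -/
def locScaleQuantile (qY : ℝ) (n : ℕ) (x : ℕ → ℝ) : ℝ :=
  sampleMean n x + √(sampleVariance n x) * qY

/-! ### Population quantities -/

section Population

variable {Ω : Type*} [MeasurableSpace Ω]

/-- Distribution function of the random variable `X`. -/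
def distFun (X : Ω → ℝ) (P : Measure Ω) (x : ℝ) : ℝ :=
  cdf (P.map X) x

/-- Quantile of order `p`: `inf {x | p ≤ F_X x}`. -/
def quantile (X : Ω → ℝ) (P : Measure Ω) (p : ℝ) : ℝ :=
  sInf {x : ℝ | p ≤ distFun X P x}

/-- Standard deviation. -/
def stdDev (X : Ω → ℝ) (P : Measure Ω) : ℝ :=
  √(Var[X; P])

/-- The standardised variable `(X - μ) / σ`. -/
def standardized (X : Ω → ℝ) (P : Measure Ω) : Ω → ℝ :=
  fun ω => (X ω - P[X]) / stdDev X P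

/-- Measure of dispersion: the variance if `r = 2`, the mean absolute deviation around the mean
if `r = 1`. -/
def dispersion (r : ℕ) (X : Ω → ℝ) (P : Measure Ω) : ℝ :=
  if r = 2 then Var[X; P] else ∫ ω, |X ω - P[X]| ∂P

/-- Pearson correlation coefficient. -/
def correlation (U V : Ω → ℝ) (P : Measure Ω) : ℝ :=
  cov[U, V; P] / √(Var[U; P] * Var[V; P])

/-- `1 + q (q (E[Y⁴] - 1) / 4 + E[Y³])`, where `q` is the quantile of order `p` of `Y`. -/
def quantileVarFactor (p : ℝ) (Y : Ω → ℝ) (P : Measure Ω) : ℝ :=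
  1 + quantile Y P p *
    (quantile Y P p * ((∫ ω, Y ω ^ 4 ∂P) - 1) / 4 + ∫ ω, Y ω ^ 3 ∂P)

/-- `Var(|X - m|^r + (2 - r) (2 F_X(m) - 1) X)`. -/
def dispersionVar (r : ℕ) (m : ℝ) (X : Ω → ℝ) (P : Measure Ω) : ℝ :=
  Var[fun ω => |X ω - m| ^ r + (2 - (r : ℝ)) * (2 * distFun X P m - 1) * X ω; P]

/-- `E[Y^{r+1}] + (2 - r) (2 F_Y(0) - 1 - 2 E[|Y|^{r+1} 1_{Y < 0}])
  + (q / 2) (E|Y|^{r+2} - E|Y|^r + (2 - r) (2 F_Y(0) - 1) E[Y³])`,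
where `q` is the quantile of order `p` of `Y`. -/
def crossFactor (r : ℕ) (p : ℝ) (Y : Ω → ℝ) (P : Measure Ω) : ℝ :=
  (∫ ω, Y ω ^ (r + 1) ∂P)
    + (2 - (r : ℝ)) * (2 * distFun Y P 0 - 1
        - 2 * ∫ ω, (Set.Iio (0 : ℝ)).indicator (fun y => |y| ^ (r + 1)) (Y ω) ∂P)
    + quantile Y P p / 2 *
        ((∫ ω, |Y ω| ^ (r + 2) ∂P) - (∫ ω, |Y ω| ^ r ∂P)
          + (2 - (r : ℝ)) * (2 * distFun Y P 0 - 1) * ∫ ω, Y ω ^ 3 ∂P)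

/-- The asymptotic covariance matrix; `d₁`, `d₂` stand for the derivatives of `h₁`, `h₂` at the
quantile and at the measure of dispersion. -/
def asympCovMatrix (r : ℕ) (p d₁ d₂ : ℝ) (X : Ω → ℝ) (P : Measure Ω) :
    Matrix (Fin 2) (Fin 2) ℝ :=
  !![stdDev X P ^ 2 * d₁ ^ 2 * quantileVarFactor p (standardized X P) P,
      stdDev X P ^ (r + 1) * d₁ * d₂ * crossFactor r p (standardized X P) P;
    stdDev X P ^ (r + 1) * d₁ * d₂ * crossFactor r p (standardized X P) P,
      d₂ ^ 2 * dispersionVar r P[X] X P]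

/-- The asymptotic correlation up to sign; it does not involve `h₁`, `h₂`. -/
def asympCorrelation (r : ℕ) (p : ℝ) (X : Ω → ℝ) (P : Measure Ω) : ℝ :=
  crossFactor r p (standardized X P) P /
    √(quantileVarFactor p (standardized X P) P * dispersionVar r 0 (standardized X P) P)

/-- From some index on, the squares `U n ^ 2` form a uniformly integrable family. -/
def EventuallySqUnifIntegrable (U : ℕ → Ω → ℝ) (P : Measure Ω) : Prop :=
  ∃ N : ℕ, UniformIntegrable (fun n => U (n + N)) 2 P

end Population

/-! ### Normalised errors of the transformed estimators -/

section Errors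

variable {Ω : Type*} [MeasurableSpace Ω]

/-- `√n (h (X̄_n + σ̂_n q_Y(p)) - h (q_X(p)))`. -/
def quantileError (h : ℝ → ℝ) (p : ℝ) (X : ℕ → Ω → ℝ) (P : Measure Ω) (n : ℕ) (ω : Ω) : ℝ :=
  √(n : ℝ) * (h (locScaleQuantile (quantile (standardized (X 0) P) P p) n (fun j => X j ω))
    - h (quantile (X 0) P p))

/-- `√n (h (D̂_{r,n}) - h (D_r))`. -/
def dispersionError (h : ℝ → ℝ) (r : ℕ) (X : ℕ → Ω → ℝ) (P : Measure Ω) (n : ℕ) (ω : Ω) : ℝ :=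
  √(n : ℝ) * (h (sampleDispersion r n (fun j => X j ω)) - h (dispersion r (X 0) P))

end Errors

end

/-!
Both estimators are asymptotically linear: `√n (T n - θ)` equals, up to an error tending to zero in
probability, the centred and normalised sum of an influence function `g (X k)`
(`IsAsymptoticallyLinear`). Everything is reduced to such sums.

*Expansion of the estimators.* The sample mean has influence function `x`. The sample variance has
influence function `(x - μ) ^ 2`, since replacing `μ` by the sample mean costs only
`√n (X̄ₙ - μ) ^ 2 → 0` in probability. Differentiable functions of asymptotically linear statistics
are asymptotically linear (`IsAsymptoticallyLinear.delta_method`); with the square root this gives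
the quantile estimator `X̄ₙ + σ̂ₙ q_Y(p)`. For the mean absolute deviation, `|x - μ - δ| - |x - μ|`
is `δ (2 1_{x ≤ μ} - 1)` up to an error of `2 |δ|` that is present only if `|x - μ| ≤ |δ|`.
With `δ = X̄ₙ - μ = O_P(n ^ (-1/2))` this error is negligible after averaging exactly because
`X` has no atom at `μ`, and the influence function is `|x - μ| + (2 F_X(μ) - 1) (x - μ)`
(`isAsymptoticallyLinear_sampleMAD`).

*Limit law.* The bivariate central limit theorem `tendstoInDistribution_normalizedSum_pair` follows
from the one-dimensional one and Lévy's continuity theorem, and Slutsky's theorem carries it over to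
the pair of estimators. The limit is centred Gaussian with the covariance matrix of the two
influence functions, which a moment computation identifies with `asympCovMatrix`
(`covMatrix_influence_eq`).

*Uniform integrability.* Normalised sums of square integrable variables have uniformly integrable
squares: truncation leaves a bounded part, whose fourth moments are bounded, and a part of small
second moment. The finite sample errors of the estimators are dominated by such sums. A
function `h` of linear growth that is differentiable at `θ` satisfies `|h x - h θ| ≤ C |x - θ|` for
all `x`, so the property passes to `h (T n)` (`EventuallySqUnifIntegrable.comp_linear_growth`).

*Correlations.* Convergence in law together with uniform integrability of the squares gives
convergence of second moments, hence of covariances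
(`tendsto_covariance_of_tendstoInDistribution`); correlations are unchanged by the affine
normalisation.
-/

/-! ### Normalised sums of independent identically distributed variables -/

section NormalizedSum

variable {Ω : Type*} [MeasurableSpace Ω] {P : Measure Ω}

/-- The centred and normalised sum `(√n)⁻¹ (ξ₀ + ⋯ + ξₙ₋₁ - n E[ξ₀])`. -/
noncomputable def normalizedSum (ξ : ℕ → Ω → ℝ) (P : Measure Ω) (n : ℕ) (ω : Ω) : ℝ :=
  (√(n : ℝ))⁻¹ * (∑ k ∈ Finset.range n, ξ k ω - n * ∫ ω', ξ 0 ω' ∂P)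

lemma normalizedSum_eq_sum_sub (ξ : ℕ → Ω → ℝ) (n : ℕ) (ω : Ω) :
    normalizedSum ξ P n ω
      = (√(n : ℝ))⁻¹ * ∑ k ∈ Finset.range n, (ξ k ω - ∫ ω', ξ 0 ω' ∂P) := by
  simp [normalizedSum, Finset.sum_sub_distrib]

lemma normalizedSum_linear {ξ η : ℕ → Ω → ℝ} (hξ : Integrable (ξ 0) P) (hη : Integrable (η 0) P)
    (a b : ℝ) (n : ℕ) (ω : Ω) :
    normalizedSum (fun k ω => a * ξ k ω + b * η k ω) P n ω
      = a * normalizedSum ξ P n ω + b * normalizedSum η P n ω := by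
  simp only [normalizedSum]
  rw [integral_add (hξ.const_mul a) (hη.const_mul b), integral_const_mul, integral_const_mul,
    Finset.sum_add_distrib, ← Finset.mul_sum, ← Finset.mul_sum]
  ring

lemma memLp_normalizedSum [IsFiniteMeasure P] {ξ : ℕ → Ω → ℝ} {q : ENNReal}
    (hident : ∀ i, IdentDistrib (ξ i) (ξ 0) P P) (hξ : MemLp (ξ 0) q P) (n : ℕ) :
    MemLp (normalizedSum ξ P n) q P := by
  refine MemLp.const_mul (f := fun ω => ∑ k ∈ Finset.range n, ξ k ω - n * ∫ ω', ξ 0 ω' ∂P)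
    (MemLp.sub (memLp_finsetSum _ fun i _ => ((hident i).memLp_iff).2 hξ) (memLp_const _)) _

lemma integral_sq_normalizedSum_le [IsProbabilityMeasure P] {ξ : ℕ → Ω → ℝ}
    (hindep : iIndepFun ξ P) (hident : ∀ i, IdentDistrib (ξ i) (ξ 0) P P)
    (hξ : MemLp (ξ 0) 2 P) (n : ℕ) :
    ∫ ω, normalizedSum ξ P n ω ^ 2 ∂P ≤ Var[ξ 0; P] := by
  have hL : ∀ i, MemLp (ξ i) 2 P := fun i => ((hident i).memLp_iff).2 hξ
  rcases Nat.eq_zero_or_pos n with rfl | hn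
  · simp [normalizedSum, variance_nonneg]
  have hmean : ∫ ω, (∑ k ∈ Finset.range n, ξ k) ω ∂P = n * ∫ ω, ξ 0 ω ∂P := by
    simp only [Finset.sum_apply]
    rw [integral_finsetSum _ fun i _ => (hL i).integrable one_le_two]
    simp [fun i => (hident i).integral_eq]
  have hvar := IndepFun.variance_sum (μ := P) (X := ξ) (s := Finset.range n) (fun i _ => hL i)
    (fun i _ j _ hij => hindep.indepFun hij)
  rw [variance_eq_integral (Finset.aemeasurable_sum _ fun i _ => (hL i).aemeasurable), hmean] at hvar
  simp only [fun i => (hident i).variance_eq, Finset.sum_const, Finset.card_range, nsmul_eq_mul,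
    Finset.sum_apply] at hvar
  simp only [normalizedSum, mul_pow, integral_const_mul, hvar]
  have : (0 : ℝ) < n := by exact_mod_cast hn
  rw [inv_pow, Real.sq_sqrt this.le, inv_mul_cancel_left₀ this.ne']

/-- Fourth moment of a sum of centred independent identically distributed variables; the lower
moments enter the induction. -/
lemma memLp_and_integral_pow_four_sum [IsProbabilityMeasure P] {ξ : ℕ → Ω → ℝ}
    (hindep : iIndepFun ξ P) (hident : ∀ i, IdentDistrib (ξ i) (ξ 0) P P)
    (hξ : MemLp (ξ 0) 4 P) (h0 : ∫ ω, ξ 0 ω ∂P = 0) (n : ℕ) :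
    MemLp (∑ k ∈ Finset.range n, ξ k) 4 P ∧ ∫ ω, (∑ k ∈ Finset.range n, ξ k) ω ∂P = 0 ∧
      ∫ ω, (∑ k ∈ Finset.range n, ξ k) ω ^ 2 ∂P = n * ∫ ω, ξ 0 ω ^ 2 ∂P ∧
      ∫ ω, (∑ k ∈ Finset.range n, ξ k) ω ^ 4 ∂P
        = n * ∫ ω, ξ 0 ω ^ 4 ∂P + 3 * n * (n - 1) * (∫ ω, ξ 0 ω ^ 2 ∂P) ^ 2 := by
  induction n with
  | zero => simp
  | succ n ih =>
    obtain ⟨hS, hS1, hS2, hS4⟩ := ih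
    have hm : ∀ i, AEMeasurable (ξ i) P := fun i => (hident i).aemeasurable_fst
    have hx : MemLp (ξ n) 4 P := ((hident n).memLp_iff).2 hξ
    have hx1 : ∫ ω, ξ n ω ∂P = 0 := (hident n).integral_eq.trans h0
    have hx2 : ∫ ω, ξ n ω ^ 2 ∂P = ∫ ω, ξ 0 ω ^ 2 ∂P :=
      ((hident n).comp (u := fun x => x ^ 2) (by fun_prop)).integral_eq
    have hx4 : ∫ ω, ξ n ω ^ 4 ∂P = ∫ ω, ξ 0 ω ^ 4 ∂P :=
      ((hident n).comp (u := fun x => x ^ 4) (by fun_prop)).integral_eq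
    have hI : (∑ k ∈ Finset.range n, ξ k) ⟂ᵢ[P] ξ n :=
      hindep.indepFun_finsetSum_of_notMem₀ hm (by simp)
    rw [Finset.sum_range_succ]
    generalize (∑ k ∈ Finset.range n, ξ k) = S at hS hS1 hS2 hS4 hI ⊢
    generalize ξ n = x at hx hx1 hx2 hx4 hI ⊢
    have hpow : ∀ {f : Ω → ℝ}, MemLp f 4 P → ∀ k : ℕ, k ≤ 4 → Integrable (fun ω => f ω ^ k) P := by
      intro f hf k hk
      rcases Nat.eq_zero_or_pos k with rfl | hk0
      · simp
      have := (hf.mono_exponent (p := (k : ENNReal)) (by exact_mod_cast hk)).integrable_norm_pow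
        (by omega)
      refine this.mono' (hf.aestronglyMeasurable.pow k) (ae_of_all _ fun ω => by simp)
    have hIjk : ∀ j k : ℕ, (fun ω => S ω ^ j) ⟂ᵢ[P] (fun ω => x ω ^ k) := fun j k =>
      hI.comp (φ := fun y : ℝ => y ^ j) (ψ := fun y : ℝ => y ^ k) (by fun_prop) (by fun_prop)
    have hint : ∀ j k : ℕ, j ≤ 4 → k ≤ 4 → Integrable (fun ω => S ω ^ j * x ω ^ k) P :=
      fun j k hj hk => (hIjk j k).integrable_mul (hpow hS j hj) (hpow hx k hk)
    have hval : ∀ j k : ℕ, j ≤ 4 → k ≤ 4 → ∫ ω, S ω ^ j * x ω ^ k ∂P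
        = (∫ ω, S ω ^ j ∂P) * ∫ ω, x ω ^ k ∂P := fun j k hj hk =>
      (hIjk j k).integral_fun_mul_eq_mul_integral (hpow hS j hj).aestronglyMeasurable
        (hpow hx k hk).aestronglyMeasurable
    refine ⟨hS.add hx, ?_, ?_, ?_⟩
    · simp only [Pi.add_apply]
      rw [integral_add (hS.integrable (by norm_num)) (hx.integrable (by norm_num)), hS1, hx1,
        add_zero]
    · have e : ∀ ω, (S + x) ω ^ 2 = S ω ^ 2 + (2 * (S ω ^ 1 * x ω ^ 1) + x ω ^ 2) := fun ω => by
        simp only [Pi.add_apply]; ring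
      simp_rw [e]
      rw [integral_add (hpow hS 2 (by norm_num))
        (((hint 1 1 (by norm_num) (by norm_num)).const_mul 2).fun_add (hpow hx 2 (by norm_num))),
        integral_add ((hint 1 1 (by norm_num) (by norm_num)).const_mul 2)
        (hpow hx 2 (by norm_num)), integral_const_mul, hval 1 1 (by norm_num) (by norm_num)]
      simp only [pow_one, hS1, hx1, hS2, hx2]
      push_cast
      ring
    · have e : ∀ ω, (S + x) ω ^ 4 = S ω ^ 4 + (4 * (S ω ^ 3 * x ω ^ 1)
          + (6 * (S ω ^ 2 * x ω ^ 2) + (4 * (S ω ^ 1 * x ω ^ 3) + x ω ^ 4))) := fun ω => by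
        simp only [Pi.add_apply]; ring
      have i4 := hpow hx 4 (by norm_num)
      have i3 := (hint 1 3 (by norm_num) (by norm_num)).const_mul 4
      have i2 := (hint 2 2 (by norm_num) (by norm_num)).const_mul 6
      have i1 := (hint 3 1 (by norm_num) (by norm_num)).const_mul 4
      simp_rw [e]
      rw [integral_add (hpow hS 4 (by norm_num)) (i1.fun_add (i2.fun_add (i3.fun_add i4))),
        integral_add i1 (i2.fun_add (i3.fun_add i4)), integral_add i2 (i3.fun_add i4),
        integral_add i3 i4, integral_const_mul, integral_const_mul, integral_const_mul,
        hval 3 1 (by norm_num) (by norm_num), hval 2 2 (by norm_num) (by norm_num),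
        hval 1 3 (by norm_num) (by norm_num)]
      simp only [pow_one, hS1, hx1, hS2, hx2, hS4, hx4]
      push_cast
      ring

lemma exists_integral_pow_four_normalizedSum_le [IsProbabilityMeasure P] {ξ : ℕ → Ω → ℝ}
    (hindep : iIndepFun ξ P) (hident : ∀ i, IdentDistrib (ξ i) (ξ 0) P P)
    (hξ : MemLp (ξ 0) 4 P) :
    ∃ K : ℝ, 0 ≤ K ∧ ∀ n, ∫ ω, normalizedSum ξ P n ω ^ 4 ∂P ≤ K := by
  set m := ∫ ω, ξ 0 ω ∂P with hm
  set κ := ∫ ω, (ξ 0 ω - m) ^ 4 ∂P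
  set s := ∫ ω, (ξ 0 ω - m) ^ 2 ∂P
  have hκ : 0 ≤ κ := integral_nonneg fun ω => by positivity
  refine ⟨κ + 3 * s ^ 2, by positivity, fun n => ?_⟩
  have hc0 : ∫ ω, (ξ 0 ω - m) ∂P = 0 := by
    rw [integral_sub (hξ.integrable (by norm_num)) (integrable_const _)]
    simp [hm]
  obtain ⟨-, -, -, h4⟩ := memLp_and_integral_pow_four_sum (ξ := fun k ω => ξ k ω - m)
    (hindep.comp (fun _ x => x - m) fun _ => by fun_prop)
    (fun i => (hident i).comp (u := fun x => x - m) (by fun_prop))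
    (hξ.sub (memLp_const m)) hc0 n
  have e : ∀ ω, normalizedSum ξ P n ω ^ 4
      = ((√(n : ℝ))⁻¹) ^ 4 * (∑ k ∈ Finset.range n, fun ω => ξ k ω - m) ω ^ 4 := fun ω => by
    rw [normalizedSum_eq_sum_sub, mul_pow, Finset.sum_apply]
  simp_rw [e]
  rw [integral_const_mul, h4]
  rcases Nat.eq_zero_or_pos n with rfl | hn
  · simp; positivity
  have hn1 : (1 : ℝ) ≤ n := by exact_mod_cast hn
  have hn0 : (0 : ℝ) < n := by linarith
  have : ((√(n : ℝ))⁻¹) ^ 4 = ((n : ℝ) ^ 2)⁻¹ := by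
    rw [inv_pow, show (4 : ℕ) = 2 * 2 by norm_num, pow_mul, Real.sq_sqrt hn0.le]
  rw [this, inv_mul_le_iff₀ (by positivity)]
  have h1 : n * κ ≤ (n : ℝ) ^ 2 * κ := by
    apply mul_le_mul_of_nonneg_right _ hκ
    nlinarith
  have h2 : 3 * (n : ℝ) * (n - 1) * s ^ 2 ≤ (n : ℝ) ^ 2 * (3 * s ^ 2) := by
    have : 0 ≤ s ^ 2 := by positivity
    nlinarith [mul_nonneg hn0.le this]
  change n * κ + 3 * n * (n - 1) * s ^ 2 ≤ _
  linarith

end NormalizedSum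

/-! ### Uniform integrability of squares -/

section UniformIntegrable

variable {Ω ι : Type*} [MeasurableSpace Ω] {P : Measure Ω}

lemma MeasureTheory.MemLp.integrable_pow_four {f : Ω → ℝ} (hf : MemLp f 4 P) :
    Integrable (fun ω => f ω ^ 4) P := by
  refine (hf.integrable_norm_pow (p := 4) (by norm_num)).congr (ae_of_all _ fun ω => ?_)
  simp only [Real.norm_eq_abs]
  rw [show (4 : ℕ) = 2 * 2 by norm_num, pow_mul, pow_mul, sq_abs]

lemma MeasureTheory.MemLp.sq_of_four {f : Ω → ℝ} (hf : MemLp f 4 P) :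
    MemLp (fun ω => f ω ^ 2) 2 P := by
  refine (memLp_two_iff_integrable_sq (hf.aestronglyMeasurable.pow 2)).2 ?_
  simpa only [Pi.pow_apply, ← pow_mul] using hf.integrable_pow_four

lemma eLpNorm_two_eq_ofReal_sqrt {f : Ω → ℝ} (hf : MemLp f 2 P) :
    eLpNorm f 2 P = ENNReal.ofReal (√(∫ ω, f ω ^ 2 ∂P)) := by
  rw [hf.eLpNorm_eq_integral_rpow_norm (by norm_num) (by norm_num), Real.sqrt_eq_rpow]
  simp

lemma integral_mul_eq_polarization {f g : Ω → ℝ} (hf : MemLp f 2 P) (hg : MemLp g 2 P) :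
    ∫ ω, f ω * g ω ∂P
      = (∫ ω, (f ω + g ω) ^ 2 ∂P - ∫ ω, f ω ^ 2 ∂P - ∫ ω, g ω ^ 2 ∂P) / 2 := by
  have h : MemLp (fun ω => f ω + g ω) 2 P := hf.add hg
  rw [← integral_sub h.integrable_sq hf.integrable_sq,
    ← integral_sub (h.integrable_sq.sub' hf.integrable_sq) hg.integrable_sq, ← integral_div]
  congr 1 with ω
  ring

lemma MeasureTheory.UniformIntegrable.of_le_norm {f g : ι → Ω → ℝ} {q : ENNReal}
    (hg : UniformIntegrable g q P) (hf : ∀ i, AEStronglyMeasurable (f i) P)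
    (hfg : ∀ i, ∀ᵐ ω ∂P, |f i ω| ≤ |g i ω|) : UniformIntegrable f q P := by
  refine ⟨hf, fun ε hε => ?_, ?_⟩
  · obtain ⟨δ, hδ, h⟩ := hg.2.1 hε
    refine ⟨δ, hδ, fun i s hs hPs => (eLpNorm_mono_ae ?_).trans (h i s hs hPs)⟩
    filter_upwards [hfg i] with ω hω
    by_cases hs : ω ∈ s <;> simp [hs, hω]
  · obtain ⟨C, hC⟩ := hg.2.2
    exact ⟨C, fun i => (eLpNorm_mono_ae (hfg i)).trans (hC i)⟩

lemma MeasureTheory.UniformIntegrable.comp_index {κ : Type*} {f : ι → Ω → ℝ} {q : ENNReal}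
    (hf : UniformIntegrable f q P) (k : κ → ι) : UniformIntegrable (fun i => f (k i)) q P :=
  ⟨fun _ => hf.1 _, fun _ hε => (hf.2.1 hε).imp fun _ h => ⟨h.1, fun _ => h.2 _⟩,
    hf.2.2.imp fun _ h _ => h _⟩

lemma MeasureTheory.UniformIntegrable.add_real {f g : ι → Ω → ℝ} {q : ENNReal} (hq : 1 ≤ q)
    (hf : UniformIntegrable f q P) (hg : UniformIntegrable g q P) :
    UniformIntegrable (fun i ω => f i ω + g i ω) q P := by
  refine ⟨fun i => (hf.1 i).add (hg.1 i), hf.2.1.add hg.2.1 hq hf.1 hg.1, ?_⟩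
  obtain ⟨C, hC⟩ := hf.2.2
  obtain ⟨D, hD⟩ := hg.2.2
  exact ⟨C + D, fun i => (eLpNorm_add_le (hf.1 i) (hg.1 i) hq).trans (by
    push_cast; exact add_le_add (hC i) (hD i))⟩

lemma MeasureTheory.UniformIntegrable.const_mul_real {f : ι → Ω → ℝ} {q : ENNReal}
    (hf : UniformIntegrable f q P) (c : ℝ) : UniformIntegrable (fun i ω => c * f i ω) q P := by
  have key : ∀ g : Ω → ℝ, eLpNorm (fun ω => c * g ω) q P = ‖c‖ₑ * eLpNorm g q P := fun g =>
    eLpNorm_const_smul c g q P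
  refine ⟨fun i => (hf.1 i).const_mul c, fun ε hε => ?_, ?_⟩
  · obtain ⟨δ, hδ, h⟩ := hf.2.1 (div_pos hε (show 0 < |c| + 1 by positivity))
    refine ⟨δ, hδ, fun i s hs hPs => ?_⟩
    have : s.indicator (fun ω => c * f i ω) = fun ω => c * s.indicator (f i) ω := by
      ext ω; by_cases hω : ω ∈ s <;> simp [hω]
    rw [this, key]
    calc ‖c‖ₑ * eLpNorm (s.indicator (f i)) q P
        ≤ ENNReal.ofReal |c| * ENNReal.ofReal (ε / (|c| + 1)) := by
          rw [← Real.norm_eq_abs, ofReal_norm]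
          gcongr
          exact h i s hs hPs
      _ = ENNReal.ofReal (|c| * (ε / (|c| + 1))) := (ENNReal.ofReal_mul (abs_nonneg c)).symm
      _ ≤ ENNReal.ofReal ε := by
          apply ENNReal.ofReal_le_ofReal
          rw [mul_div_assoc', div_le_iff₀ (by positivity)]
          nlinarith
  · obtain ⟨C, hC⟩ := hf.2.2
    refine ⟨‖c‖₊ * C, fun i => ?_⟩
    rw [key]
    push_cast
    gcongr
    · exact le_rfl
    · exact hC i

/-- A family that can be split, up to an arbitrarily small error in `L²`, into a part bounded in
`L⁴` has uniformly integrable squares. -/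
lemma uniformIntegrable_two_of_forall_split [IsProbabilityMeasure P] {f : ι → Ω → ℝ}
    (h : ∀ ε > 0, ∃ K : ℝ, 0 ≤ K ∧ ∀ i, ∃ g r : Ω → ℝ, (∀ ω, f i ω = g ω + r ω) ∧ MemLp g 4 P ∧
      ∫ ω, g ω ^ 4 ∂P ≤ K ∧ MemLp r 2 P ∧ ∫ ω, r ω ^ 2 ∂P ≤ ε ^ 2) :
    UniformIntegrable f 2 P := by
  -- `y² ≤ a y⁴ + a⁻¹`, integrated over `s`
  have key : ∀ (g : Ω → ℝ) (K a : ℝ), MemLp g 4 P → ∫ ω, g ω ^ 4 ∂P ≤ K → 0 < a →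
      ∀ s, MeasurableSet s →
      eLpNorm (s.indicator g) 2 P ≤ ENNReal.ofReal (√(a * K + a⁻¹ * P.real s)) := by
    intro g K a hg hK ha s hs
    have hg2 : MemLp g 2 P := hg.mono_exponent (by norm_num)
    rw [eLpNorm_two_eq_ofReal_sqrt (hg2.indicator hs)]
    gcongr
    have hle : ∀ ω, s.indicator g ω ^ 2 ≤ a * g ω ^ 4 + a⁻¹ * s.indicator (fun _ => (1 : ℝ)) ω := by
      intro ω
      by_cases hω : ω ∈ s
      · simp only [Set.indicator_of_mem hω, mul_one]
        have h1 : a⁻¹ * (a * g ω ^ 2 - 1) ^ 2 = a * g ω ^ 4 + a⁻¹ - 2 * g ω ^ 2 := by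
          field_simp; ring
        have h2 : 0 ≤ a⁻¹ * (a * g ω ^ 2 - 1) ^ 2 := by positivity
        nlinarith [sq_nonneg (g ω)]
      · simp only [Set.indicator_of_notMem hω]
        have : 0 ≤ g ω ^ 4 := by positivity
        simp; positivity
    have hind : Integrable (s.indicator fun _ => (1 : ℝ)) P := (integrable_const 1).indicator hs
    calc ∫ ω, s.indicator g ω ^ 2 ∂P
        ≤ ∫ ω, a * g ω ^ 4 + a⁻¹ * s.indicator (fun _ => (1 : ℝ)) ω ∂P :=
          integral_mono (hg2.indicator hs).integrable_sq
            ((hg.integrable_pow_four.const_mul a).add (hind.const_mul _)) hle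
      _ = a * ∫ ω, g ω ^ 4 ∂P + a⁻¹ * P.real s := by
          rw [integral_add (hg.integrable_pow_four.const_mul a) (hind.const_mul _), integral_const_mul,
            integral_const_mul, integral_indicator_const _ hs]
          simp
      _ ≤ a * K + a⁻¹ * P.real s := by gcongr
  have hsplit : ∀ (i : ι) (g r : Ω → ℝ) (ε : ℝ), 0 < ε → (∀ ω, f i ω = g ω + r ω) → MemLp g 4 P →
      MemLp r 2 P → ∫ ω, r ω ^ 2 ∂P ≤ ε ^ 2 → ∀ s, MeasurableSet s →
      eLpNorm (s.indicator (f i)) 2 P ≤ eLpNorm (s.indicator g) 2 P + ENNReal.ofReal ε := by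
    intro i g r ε hε hf hg hr hr2 s hs
    have : s.indicator (f i) = s.indicator g + s.indicator r := by
      rw [show f i = g + r from funext hf, Set.indicator_add']
    rw [this]
    refine (eLpNorm_add_le (hg.aestronglyMeasurable.indicator hs)
      (hr.aestronglyMeasurable.indicator hs) (by norm_num)).trans ?_
    gcongr
    refine (eLpNorm_indicator_le _).trans ?_
    rw [eLpNorm_two_eq_ofReal_sqrt hr]
    exact ENNReal.ofReal_le_ofReal (Real.sqrt_le_iff.2 ⟨hε.le, hr2⟩)
  refine ⟨fun i => ?_, fun ε hε => ?_, ?_⟩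
  · obtain ⟨K, -, hK⟩ := h 1 one_pos
    obtain ⟨g, r, hf, hg, -, hr, -⟩ := hK i
    rw [show f i = g + r from funext hf]
    exact hg.aestronglyMeasurable.add hr.aestronglyMeasurable
  · obtain ⟨K, hK0, hK⟩ := h (ε / 2) (half_pos hε)
    -- this `a` bounds `a * K`, and small `P s` bounds `a⁻¹ * P s`, each by `(ε / 2) ^ 2 / 2`
    set a := (ε / 2) ^ 2 / 2 / (K + 1) with ha_def
    have ha : 0 < a := by positivity
    refine ⟨a * ((ε / 2) ^ 2 / 2), by positivity, fun i s hs hPs => ?_⟩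
    obtain ⟨g, r, hf, hg, hgK, hr, hr2⟩ := hK i
    refine (hsplit i g r (ε / 2) (half_pos hε) hf hg hr hr2 s hs).trans ?_
    have hs' : P.real s ≤ a * ((ε / 2) ^ 2 / 2) := ENNReal.toReal_le_of_le_ofReal (by positivity) hPs
    have h1 : a * K + a⁻¹ * P.real s ≤ (ε / 2) ^ 2 := by
      have h2 : a⁻¹ * P.real s ≤ (ε / 2) ^ 2 / 2 := by
        rw [inv_mul_le_iff₀ ha]; exact hs'
      have h3 : a * K ≤ (ε / 2) ^ 2 / 2 := by
        rw [ha_def, div_mul_eq_mul_div, div_le_iff₀ (by positivity)]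
        have : 0 ≤ (ε / 2) ^ 2 / 2 := by positivity
        nlinarith
      linarith
    calc _ ≤ ENNReal.ofReal (ε / 2) + ENNReal.ofReal (ε / 2) := by
          gcongr
          refine (key g K a hg hgK ha s hs).trans (ENNReal.ofReal_le_ofReal ?_)
          exact Real.sqrt_le_iff.2 ⟨by positivity, h1⟩
      _ = ENNReal.ofReal ε := by
          rw [← ENNReal.ofReal_add (by positivity) (by positivity), add_halves]
  · obtain ⟨K, hK0, hK⟩ := h 1 one_pos
    refine ⟨(√(1 * K + 1⁻¹ * 1)).toNNReal + (1 : ℝ).toNNReal, fun i => ?_⟩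
    obtain ⟨g, r, hf, hg, hgK, hr, hr2⟩ := hK i
    have h1 := hsplit i g r 1 one_pos hf hg hr hr2 Set.univ MeasurableSet.univ
    have h2 := key g K 1 hg hgK one_pos Set.univ MeasurableSet.univ
    simp only [Set.indicator_univ, probReal_univ] at h1 h2
    refine h1.trans ?_
    push_cast
    exact add_le_add h2 le_rfl

/-- The squares of the normalised sums of square integrable independent identically distributed
variables are uniformly integrable: truncation splits off a part that is bounded in `L⁴`. -/
theorem uniformIntegrable_normalizedSum [IsProbabilityMeasure P] {ξ : ℕ → Ω → ℝ}
    (hindep : iIndepFun ξ P) (hident : ∀ i, IdentDistrib (ξ i) (ξ 0) P P)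
    (hξ : MemLp (ξ 0) 2 P) : UniformIntegrable (normalizedSum ξ P) 2 P := by
  have hm := (hident 0).aemeasurable_fst
  refine uniformIntegrable_two_of_forall_split fun ε hε => ?_
  have hid : MemLp (id : ℝ → ℝ) 2 (P.map (ξ 0)) :=
    (memLp_map_measure_iff aestronglyMeasurable_id hm).2 hξ
  obtain ⟨M, hM⟩ := hid.eLpNorm_indicator_norm_ge_le stronglyMeasurable_id hε
  set S : Set ℝ := {x | M ≤ ‖id x‖₊} with hS_def
  have hS : MeasurableSet S := measurableSet_le measurable_const (by fun_prop)
  -- `b` is the tail of the identity, `a` the truncation of the identity at level `M`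
  set b : ℝ → ℝ := S.indicator id with hb_def
  have hb : Measurable b := measurable_id.indicator hS
  have hbL : MemLp (b ∘ ξ 0) 2 P := by
    rw [← memLp_map_measure_iff hb.aestronglyMeasurable hm]
    exact hid.indicator hS
  have hb2 : ∫ ω, b (ξ 0 ω) ^ 2 ∂P ≤ ε ^ 2 := by
    have h1 : eLpNorm (b ∘ ξ 0) 2 P ≤ ENNReal.ofReal ε := by
      rw [← eLpNorm_map_measure hb.aestronglyMeasurable hm]
      exact hM
    rw [eLpNorm_two_eq_ofReal_sqrt hbL, ENNReal.ofReal_le_ofReal_iff hε.le, Real.sqrt_le_iff] at h1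
    exact h1.2
  set a : ℝ → ℝ := fun x => x - b x with ha_def
  have ha : Measurable a := measurable_id.sub hb
  have hab : ∀ x, |a x| ≤ |M| := by
    intro x
    by_cases hx : x ∈ S
    · simp [ha_def, hb_def, hx]
    · simp only [ha_def, hb_def, Set.indicator_of_notMem hx, sub_zero]
      have : ¬ (M ≤ |x|) := by simpa [hS_def] using hx
      exact (not_le.1 this).le.trans (le_abs_self M)
  have haL : MemLp (a ∘ ξ 0) 4 P :=
    MemLp.of_bound (ha.comp_aemeasurable hm).aestronglyMeasurable |M| (ae_of_all _ fun ω => hab _)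
  obtain ⟨K, hK0, hK⟩ := exists_integral_pow_four_normalizedSum_le
    (ξ := fun k => a ∘ ξ k) (hindep.comp (fun _ => a) fun _ => ha) (fun i => (hident i).comp ha) haL
  refine ⟨K, hK0, fun n => ⟨normalizedSum (fun k => a ∘ ξ k) P n,
    normalizedSum (fun k => b ∘ ξ k) P n, fun ω => ?_,
    memLp_normalizedSum (ξ := fun k => a ∘ ξ k) (fun i => (hident i).comp ha) haL n, hK n,
    memLp_normalizedSum (ξ := fun k => b ∘ ξ k) (fun i => (hident i).comp hb) hbL n, ?_⟩⟩
  · have := normalizedSum_linear (ξ := fun k => a ∘ ξ k) (η := fun k => b ∘ ξ k)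
      (haL.integrable (by norm_num)) (hbL.integrable (by norm_num)) 1 1 n ω
    simpa [ha_def] using this
  · refine (integral_sq_normalizedSum_le (ξ := fun k => b ∘ ξ k) (hindep.comp (fun _ => b) fun _ => hb)
      (fun i => (hident i).comp hb) hbL n).trans ?_
    exact (variance_le_expectation_sq hbL.aestronglyMeasurable).trans hb2

/-- For independent identically distributed variables in `L⁴`, the squares of `Zₙ² / √n` are
uniformly integrable, because `E[Zₙ⁴] / n` tends to zero. -/
theorem uniformIntegrable_sq_normalizedSum_div_sqrt [IsProbabilityMeasure P] {ξ : ℕ → Ω → ℝ}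
    (hindep : iIndepFun ξ P) (hident : ∀ i, IdentDistrib (ξ i) (ξ 0) P P)
    (hξ : MemLp (ξ 0) 4 P) :
    UniformIntegrable (fun (n : ℕ) ω => normalizedSum ξ P n ω ^ 2 / √(n : ℝ)) 2 P := by
  obtain ⟨K, hK0, hK⟩ := exists_integral_pow_four_normalizedSum_le hindep hident hξ
  have hZ := fun n => memLp_normalizedSum hident hξ n
  have hL : ∀ n : ℕ, MemLp (fun ω => normalizedSum ξ P n ω ^ 2 / √(n : ℝ)) 2 P := fun n => by
    simp only [div_eq_inv_mul]
    exact (hZ n).sq_of_four.const_mul _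
  have hle : ∀ n : ℕ, eLpNorm (fun ω => normalizedSum ξ P n ω ^ 2 / √(n : ℝ)) 2 P
      ≤ ENNReal.ofReal (√(K / n)) := fun n => by
    rw [eLpNorm_two_eq_ofReal_sqrt (hL n)]
    gcongr
    simp only [div_pow, Real.sq_sqrt (Nat.cast_nonneg n), integral_div]
    gcongr
    simpa [← pow_mul] using hK n
  refine ⟨fun n => (hL n).aestronglyMeasurable, ?_, (√K).toNNReal, fun n => ?_⟩
  · refine unifIntegrable_of_tendsto_Lp_zero (by norm_num) (by norm_num) hL ?_
    refine tendsto_of_tendsto_of_tendsto_of_le_of_le tendsto_const_nhds ?_ (fun _ => zero_le) hle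
    have : Tendsto (fun n : ℕ => √(K / n)) atTop (𝓝 0) := by
      simpa using (tendsto_const_div_atTop_nhds_zero_nat K).sqrt
    simpa using ENNReal.tendsto_ofReal this
  · refine (hle n).trans (ENNReal.ofReal_le_ofReal (Real.sqrt_le_sqrt ?_))
    rcases Nat.eq_zero_or_pos n with rfl | hn
    · simpa using hK0
    · exact div_le_self hK0 (by exact_mod_cast hn)

end UniformIntegrable

/-! ### Convergence in probability to zero -/

section ConvergenceInMeasure

variable {Ω : Type*} [MeasurableSpace Ω] {P : Measure Ω}

lemma tendstoInMeasure_zero_iff [IsFiniteMeasure P] {f : ℕ → Ω → ℝ} :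
    TendstoInMeasure P f atTop 0 ↔
      ∀ ε > 0, Tendsto (fun n => P.real {ω | ε ≤ |f n ω|}) atTop (𝓝 0) := by
  simp [tendstoInMeasure_iff_measureReal_norm]

/-- If an exceedance event of `h n` is covered by exceedance events of `f n` and `g n`, then
convergence to zero in probability passes from `f` and `g` to `h`. -/
lemma tendstoInMeasure_zero_of_subset_union [IsFiniteMeasure P] {f g h : ℕ → Ω → ℝ}
    (hf : TendstoInMeasure P f atTop 0) (hg : TendstoInMeasure P g atTop 0)
    (hh : ∀ ε > 0, ∃ a > 0, ∃ b > 0, ∀ n ω, ε ≤ |h n ω| → a ≤ |f n ω| ∨ b ≤ |g n ω|) :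
    TendstoInMeasure P h atTop 0 := by
  rw [tendstoInMeasure_zero_iff] at *
  intro ε hε
  obtain ⟨a, ha, b, hb, hab⟩ := hh ε hε
  refine tendsto_of_tendsto_of_tendsto_of_le_of_le tendsto_const_nhds
    (by simpa using (hf a ha).add (hg b hb)) (fun _ => measureReal_nonneg) fun n => ?_
  exact (measureReal_mono fun ω hω => hab n ω hω).trans (measureReal_union_le _ _)

lemma MeasureTheory.TendstoInMeasure.add_zero_real [IsFiniteMeasure P] {f g : ℕ → Ω → ℝ}
    (hf : TendstoInMeasure P f atTop 0) (hg : TendstoInMeasure P g atTop 0) :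
    TendstoInMeasure P (fun n ω => f n ω + g n ω) atTop 0 := by
  refine tendstoInMeasure_zero_of_subset_union hf hg fun ε hε =>
    ⟨ε / 2, half_pos hε, ε / 2, half_pos hε, fun n ω h => ?_⟩
  by_contra! hc
  linarith [abs_add_le (f n ω) (g n ω)]

lemma MeasureTheory.TendstoInMeasure.mul_zero_real [IsFiniteMeasure P] {f g : ℕ → Ω → ℝ}
    (hf : TendstoInMeasure P f atTop 0) (hg : TendstoInMeasure P g atTop 0) :
    TendstoInMeasure P (fun n ω => f n ω * g n ω) atTop 0 := by
  refine tendstoInMeasure_zero_of_subset_union hf hg fun ε hε =>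
    ⟨1, one_pos, ε, hε, fun n ω h => ?_⟩
  by_contra! hc
  rw [abs_mul] at h
  nlinarith [abs_nonneg (f n ω), abs_nonneg (g n ω)]

lemma MeasureTheory.TendstoInMeasure.const_mul_zero_real [IsFiniteMeasure P] {f : ℕ → Ω → ℝ}
    (hf : TendstoInMeasure P f atTop 0) (c : ℝ) :
    TendstoInMeasure P (fun n ω => c * f n ω) atTop 0 := by
  refine tendstoInMeasure_zero_of_subset_union hf hf fun ε hε =>
    ⟨ε / (|c| + 1), by positivity, ε / (|c| + 1), by positivity, fun n ω h => Or.inl ?_⟩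
  rw [abs_mul] at h
  rw [div_le_iff₀ (by positivity)]
  nlinarith [abs_nonneg (f n ω)]

/-- A sequence bounded in `L²` times a sequence tending to zero in probability tends to zero in
probability. -/
lemma MeasureTheory.TendstoInMeasure.mul_of_integral_sq_le [IsProbabilityMeasure P]
    {f Z : ℕ → Ω → ℝ} {C : ℝ} (hf : TendstoInMeasure P f atTop 0) (hZ : ∀ n, MemLp (Z n) 2 P)
    (hC : ∀ n, ∫ ω, Z n ω ^ 2 ∂P ≤ C) :
    TendstoInMeasure P (fun n ω => f n ω * Z n ω) atTop 0 := by
  rw [tendstoInMeasure_zero_iff] at *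
  intro ε hε
  have hC0 : 0 ≤ C := (integral_nonneg fun ω => sq_nonneg _).trans (hC 0)
  rw [Metric.tendsto_atTop]
  intro η hη
  -- by Chebyshev's inequality `|Z n|` exceeds this `K` with probability below `η / 2`
  obtain ⟨K, hK0, hK⟩ : ∃ K : ℝ, 0 < K ∧ C / K ^ 2 < η / 2 := by
    refine ⟨√(2 * C / η) + 1, by positivity, ?_⟩
    have h1 : (√(2 * C / η)) ^ 2 = 2 * C / η := Real.sq_sqrt (by positivity)
    have h2 : 2 * C / η < (√(2 * C / η) + 1) ^ 2 := by nlinarith [Real.sqrt_nonneg (2 * C / η)]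
    rw [div_lt_iff₀ hη] at h2
    rw [div_lt_iff₀ (by positivity)]
    linarith
  obtain ⟨N, hN⟩ := Metric.tendsto_atTop.1 (hf (ε / K) (by positivity)) (η / 2) (half_pos hη)
  refine ⟨N, fun n hn => ?_⟩
  have h1 := hN n hn
  simp only [dist_zero_right, Real.norm_eq_abs, abs_of_nonneg measureReal_nonneg] at h1 ⊢
  have h2 : P.real {ω | K ≤ |Z n ω|} ≤ C / K ^ 2 := by
    rw [le_div_iff₀ (by positivity)]
    have := mul_meas_ge_le_integral_of_nonneg (μ := P) (f := fun ω => Z n ω ^ 2)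
      (ae_of_all _ fun ω => sq_nonneg _) (hZ n).integrable_sq (K ^ 2)
    have e : {ω | K ≤ |Z n ω|} = {ω | K ^ 2 ≤ Z n ω ^ 2} := by
      ext ω
      simp only [Set.mem_ofPred_eq]
      rw [← sq_abs (Z n ω), pow_le_pow_iff_left₀ hK0.le (abs_nonneg _) two_ne_zero]
    rw [e]
    linarith [hC n]
  calc P.real {ω | ε ≤ |f n ω * Z n ω|}
      ≤ P.real ({ω | ε / K ≤ |f n ω|} ∪ {ω | K ≤ |Z n ω|}) := by
        refine measureReal_mono fun ω hω => ?_
        by_contra hc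
        simp only [Set.mem_union, Set.mem_ofPred_eq, not_or, not_le, lt_div_iff₀ hK0] at hc hω
        rw [abs_mul] at hω
        nlinarith [abs_nonneg (f n ω), abs_nonneg (Z n ω)]
    _ ≤ _ := measureReal_union_le _ _
    _ < η := by linarith

end ConvergenceInMeasure

/-! ### Sequences with eventually uniformly integrable squares -/

section EventuallySqUnifIntegrable

variable {Ω : Type*} [MeasurableSpace Ω] {P : Measure Ω} {U V : ℕ → Ω → ℝ}

lemma EventuallySqUnifIntegrable.exists_forall_ge (hU : EventuallySqUnifIntegrable U P) :
    ∃ N : ℕ, ∀ M ≥ N, UniformIntegrable (fun n => U (n + M)) 2 P := by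
  obtain ⟨N, hN⟩ := hU
  refine ⟨N, fun M hM => ?_⟩
  have := hN.comp_index (fun n => n + (M - N))
  simpa only [add_assoc, Nat.sub_add_cancel hM] using this

lemma EventuallySqUnifIntegrable.eventually_memLp (hU : EventuallySqUnifIntegrable U P) :
    ∀ᶠ n in atTop, MemLp (U n) 2 P := by
  obtain ⟨N, hN⟩ := hU
  filter_upwards [eventually_ge_atTop N] with n hn
  simpa [Nat.sub_add_cancel hn] using hN.memLp (n - N)

lemma MeasureTheory.UniformIntegrable.eventuallySqUnifIntegrable (hU : UniformIntegrable U 2 P) :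
    EventuallySqUnifIntegrable U P := ⟨0, hU⟩

lemma EventuallySqUnifIntegrable.add (hU : EventuallySqUnifIntegrable U P)
    (hV : EventuallySqUnifIntegrable V P) :
    EventuallySqUnifIntegrable (fun n ω => U n ω + V n ω) P := by
  obtain ⟨N, hN⟩ := hU.exists_forall_ge
  obtain ⟨M, hM⟩ := hV.exists_forall_ge
  exact ⟨N + M, UniformIntegrable.add_real (f := fun n => U (n + (N + M)))
    (g := fun n => V (n + (N + M))) (by norm_num) (hN _ (by omega)) (hM _ (by omega))⟩

lemma EventuallySqUnifIntegrable.const_mul (hU : EventuallySqUnifIntegrable U P) (c : ℝ) :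
    EventuallySqUnifIntegrable (fun n ω => c * U n ω) P :=
  hU.imp fun N h => UniformIntegrable.const_mul_real (f := fun n => U (n + N)) h c

lemma eventuallySqUnifIntegrable_const [IsFiniteMeasure P] (c : ℝ) :
    EventuallySqUnifIntegrable (fun _ _ => c : ℕ → Ω → ℝ) P :=
  ⟨0, uniformIntegrable_const (by norm_num) (by norm_num) (memLp_const c)⟩

lemma EventuallySqUnifIntegrable.of_eventually_le (hV : EventuallySqUnifIntegrable V P)
    (hU : ∀ n, AEStronglyMeasurable (U n) P)
    (h : ∀ᶠ n in atTop, ∀ ω, |U n ω| ≤ |V n ω|) : EventuallySqUnifIntegrable U P := by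
  obtain ⟨M, hM⟩ := eventually_atTop.1 h
  obtain ⟨N, hN⟩ := hV.exists_forall_ge
  exact ⟨N + M, (hN (N + M) (by omega)).of_le_norm (fun n => hU _)
    fun n => ae_of_all _ fun ω => hM _ (by omega) ω⟩

end EventuallySqUnifIntegrable

/-! ### Convergence in distribution -/

section Distribution

variable {Ω Ω' E : Type*} [MeasurableSpace Ω] [MeasurableSpace Ω'] {P : Measure Ω}
  [IsProbabilityMeasure P] {P' : Measure Ω'} [IsProbabilityMeasure P']

lemma MeasureTheory.TendstoInDistribution.tendsto_integral_boundedContinuous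
    {U : ℕ → Ω → ℝ} {Z : Ω' → ℝ} (h : TendstoInDistribution U atTop Z (fun _ => P) P')
    (f : BoundedContinuousFunction ℝ ℝ) :
    Tendsto (fun n => ∫ ω, f (U n ω) ∂P) atTop (𝓝 (∫ ω, f (Z ω) ∂P')) := by
  have := (ProbabilityMeasure.tendsto_iff_forall_integral_tendsto.1 h.tendsto) f
  simp only [ProbabilityMeasure.coe_mk] at this
  rw [integral_map h.aemeasurable_limit f.continuous.aestronglyMeasurable] at this
  refine this.congr fun n => ?_
  rw [integral_map (h.forall_aemeasurable n) f.continuous.aestronglyMeasurable]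

/-- Capping `Z ^ 2` at `K ^ 2` costs at most the second moment of the part of `Z` beyond `C ≤ K`. -/
lemma integral_sq_sub_integral_min_sq_le {Z : Ω → ℝ} (hZ : MemLp Z 2 P) {C K ε : ℝ} (hCK : C ≤ K)
    (hε : 0 ≤ ε)
    (h : eLpNorm ({ω | C ≤ |Z ω|}.indicator Z) 2 P ≤ ENNReal.ofReal ε) :
    |∫ ω, Z ω ^ 2 ∂P - ∫ ω, min (Z ω ^ 2) (K ^ 2) ∂P| ≤ ε ^ 2 := by
  have hS : NullMeasurableSet {ω | C ≤ |Z ω|} P :=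
    nullMeasurableSet_le aemeasurable_const hZ.aemeasurable.norm
  have hind : MemLp ({ω | C ≤ |Z ω|}.indicator Z) 2 P :=
    ⟨hZ.aestronglyMeasurable.indicator₀ hS, (h.trans_lt ENNReal.ofReal_lt_top)⟩
  rw [eLpNorm_two_eq_ofReal_sqrt hind, ENNReal.ofReal_le_ofReal_iff hε, Real.sqrt_le_iff] at h
  have hmin : Integrable (fun ω => min (Z ω ^ 2) (K ^ 2)) P :=
    hZ.integrable_sq.inf (integrable_const _)
  rw [← integral_sub hZ.integrable_sq hmin, abs_of_nonneg (integral_nonneg fun ω => by simp)]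
  refine (integral_mono (hZ.integrable_sq.sub hmin) hind.integrable_sq fun ω => ?_).trans h.2
  simp only [Pi.sub_apply]
  by_cases hω : C ≤ |Z ω|
  · rw [Set.indicator_of_mem (show ω ∈ {ω | C ≤ |Z ω|} from hω)]
    have : 0 ≤ min (Z ω ^ 2) (K ^ 2) := le_min (sq_nonneg _) (sq_nonneg _)
    linarith
  · rw [Set.indicator_of_notMem (show ω ∉ {ω | C ≤ |Z ω|} from hω)]
    have h1 : |Z ω| ≤ K := (not_le.1 hω).le.trans hCK
    have h2 : Z ω ^ 2 ≤ K ^ 2 := by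
      rw [← sq_abs]; exact pow_le_pow_left₀ (abs_nonneg _) h1 2
    simp [min_eq_left h2]

/-- Second moments converge along a sequence that converges in distribution and has uniformly
integrable squares. -/
theorem tendsto_integral_sq_of_tendstoInDistribution {U : ℕ → Ω → ℝ} {Z : Ω' → ℝ}
    (h : TendstoInDistribution U atTop Z (fun _ => P) P') (hU : EventuallySqUnifIntegrable U P)
    (hZ : MemLp Z 2 P') :
    Tendsto (fun n => ∫ ω, U n ω ^ 2 ∂P) atTop (𝓝 (∫ ω, Z ω ^ 2 ∂P')) := by
  obtain ⟨N, hN⟩ := hU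
  rw [Metric.tendsto_atTop]
  intro ε hε
  have hε' : 0 < √(ε / 3) := by positivity
  have hsq : √(ε / 3) ^ 2 = ε / 3 := Real.sq_sqrt (by positivity)
  obtain ⟨C₁, hC₁⟩ := hN.spec (by norm_num) (by norm_num) hε'
  obtain ⟨C₂, hC₂⟩ := UniformIntegrable.spec (p := 2) (by norm_num) (by norm_num)
    (uniformIntegrable_const (ι := ℕ) (by norm_num) (by norm_num) hZ) hε'
  -- one truncation level serves the whole sequence and the limit
  set K : ℝ := max C₁ C₂ with hK
  let f : BoundedContinuousFunction ℝ ℝ := BoundedContinuousFunction.ofNormedAddCommGroup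
    (fun x => min (x ^ 2) (K ^ 2)) (by fun_prop) (K ^ 2) fun x => by
      rw [Real.norm_eq_abs, abs_of_nonneg (le_min (sq_nonneg _) (sq_nonneg _))]
      exact min_le_right _ _
  obtain ⟨M, hM⟩ := Metric.tendsto_atTop.1 (h.tendsto_integral_boundedContinuous f) (ε / 3)
    (by positivity)
  have hZ' := integral_sq_sub_integral_min_sq_le hZ (le_max_right (C₁ : ℝ) C₂) hε'.le
    (by simpa [← NNReal.coe_le_coe] using hC₂ 0)
  refine ⟨max M N, fun n hn => ?_⟩
  have hn1 := hM n (le_trans (le_max_left _ _) hn)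
  have hnN : n - N + N = n := Nat.sub_add_cancel (le_trans (le_max_right _ _) hn)
  have hUm : MemLp (U n) 2 P := by simpa only [hnN] using hN.memLp (n - N)
  have hU' := integral_sq_sub_integral_min_sq_le hUm (le_max_left (C₁ : ℝ) C₂) hε'.le
    (by have := hC₁ (n - N); rw [hnN] at this; simpa [← NNReal.coe_le_coe] using this)
  change |∫ ω, min (U n ω ^ 2) (K ^ 2) ∂P - ∫ ω, min (Z ω ^ 2) (K ^ 2) ∂P'| < ε / 3 at hn1
  rw [hsq] at hU' hZ'
  rw [Real.dist_eq]
  rw [abs_le] at hU' hZ'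
  rw [abs_lt] at hn1 ⊢
  constructor <;> linarith

variable [TopologicalSpace E] [MeasurableSpace E] [OpensMeasurableSpace E]

/-- Covariances of continuous functions converge along a sequence that converges in distribution,
as soon as the squares of these functions are uniformly integrable. -/
theorem tendsto_covariance_of_tendstoInDistribution {V : ℕ → Ω → E} {Z : Ω' → E}
    (h : TendstoInDistribution V atTop Z (fun _ => P) P') {a b : E → ℝ} (ha : Continuous a)
    (hb : Continuous b) (hUa : EventuallySqUnifIntegrable (fun n ω => a (V n ω)) P)
    (hUb : EventuallySqUnifIntegrable (fun n ω => b (V n ω)) P)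
    (hZa : MemLp (fun ω => a (Z ω)) 2 P') (hZb : MemLp (fun ω => b (Z ω)) 2 P') :
    Tendsto (fun n => cov[fun ω => a (V n ω), fun ω => b (V n ω); P]) atTop
      (𝓝 cov[fun ω => a (Z ω), fun ω => b (Z ω); P']) := by
  -- second moments of linear combinations determine first moments and mixed moments
  have key : ∀ c : E → ℝ, Continuous c → EventuallySqUnifIntegrable (fun n ω => c (V n ω)) P →
      MemLp (fun ω => c (Z ω)) 2 P' →
      Tendsto (fun n => ∫ ω, c (V n ω) ^ 2 ∂P) atTop (𝓝 (∫ ω, c (Z ω) ^ 2 ∂P')) :=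
    fun c hc hU hZ => tendsto_integral_sq_of_tendstoInDistribution (h.continuous_comp hc) hU hZ
  have prod : ∀ c d : E → ℝ, Continuous c → Continuous d →
      EventuallySqUnifIntegrable (fun n ω => c (V n ω)) P →
      EventuallySqUnifIntegrable (fun n ω => d (V n ω)) P →
      MemLp (fun ω => c (Z ω)) 2 P' → MemLp (fun ω => d (Z ω)) 2 P' →
      Tendsto (fun n => ∫ ω, c (V n ω) * d (V n ω) ∂P) atTop
        (𝓝 (∫ ω, c (Z ω) * d (Z ω) ∂P')) := by
    intro c d hc hd hUc hUd hZc hZd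
    rw [integral_mul_eq_polarization hZc hZd]
    refine Tendsto.congr' ?_ ((((key (fun z => c z + d z) (hc.add hd) (hUc.add hUd)
      (hZc.add hZd)).sub (key c hc hUc hZc)).sub (key d hd hUd hZd)).div_const 2)
    filter_upwards [hUc.eventually_memLp, hUd.eventually_memLp] with n h1 h2
    exact (integral_mul_eq_polarization h1 h2).symm
  have hone : Continuous fun _ : E => (1 : ℝ) := continuous_const
  have hP1 := eventuallySqUnifIntegrable_const (P := P) 1
  have hmean_a := prod a _ ha hone hUa hP1 hZa (memLp_const 1)
  have hmean_b := prod b _ hb hone hUb hP1 hZb (memLp_const 1)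
  simp only [mul_one] at hmean_a hmean_b
  rw [covariance_eq_sub hZa hZb]
  refine Tendsto.congr' ?_ ((prod a b ha hb hUa hUb hZa hZb).sub (hmean_a.mul hmean_b))
  filter_upwards [hUa.eventually_memLp, hUb.eventually_memLp] with n h1 h2
  rw [covariance_eq_sub h1 h2]
  rfl

end Distribution

/-! ### A bivariate central limit theorem -/

section CentralLimit

variable {Ω : Type*} [MeasurableSpace Ω] {P : Measure Ω} [IsProbabilityMeasure P]

/-- The covariance matrix of a pair of random variables. -/
noncomputable def covMatrix (f g : Ω → ℝ) (P : Measure Ω) : Matrix (Fin 2) (Fin 2) ℝ :=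
  !![Var[f; P], cov[f, g; P]; cov[f, g; P], Var[g; P]]

lemma variance_linear_combination {f g : Ω → ℝ} (hf : MemLp f 2 P) (hg : MemLp g 2 P) (a b : ℝ) :
    Var[fun ω => a * f ω + b * g ω; P]
      = a ^ 2 * Var[f; P] + 2 * (a * b * cov[f, g; P]) + b ^ 2 * Var[g; P] := by
  rw [variance_fun_add (hf.const_mul a) (hg.const_mul b), variance_const_mul, variance_const_mul,
    covariance_const_mul_left, covariance_const_mul_right]
  ring

lemma posSemidef_covMatrix {f g : Ω → ℝ} (hf : MemLp f 2 P) (hg : MemLp g 2 P) :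
    (covMatrix f g P).PosSemidef := by
  refine Matrix.PosSemidef.of_dotProduct_mulVec_nonneg ?_ fun x => ?_
  · ext i j
    fin_cases i <;> fin_cases j <;> simp [covMatrix]
  · have h := variance_nonneg (fun ω => x 0 * f ω + x 1 * g ω) P
    rw [variance_linear_combination hf hg] at h
    simp [covMatrix, Matrix.mulVec, dotProduct, Fin.sum_univ_two]
    linarith

/-- Bivariate central limit theorem for `f (ξ k)` and `g (ξ k)`. By Lévy's theorem it
follows from the univariate one applied to all linear combinations of `f` and `g`. -/
theorem tendstoInDistribution_normalizedSum_pair {ξ : ℕ → Ω → ℝ} (hindep : iIndepFun ξ P)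
    (hident : ∀ i, IdentDistrib (ξ i) (ξ 0) P P) {f g : ℝ → ℝ} (hf : Measurable f)
    (hg : Measurable g) (hfL : MemLp (fun ω => f (ξ 0 ω)) 2 P)
    (hgL : MemLp (fun ω => g (ξ 0 ω)) 2 P) :
    TendstoInDistribution
      (fun (n : ℕ) (ω : Ω) => !₂[normalizedSum (fun k ω => f (ξ k ω)) P n ω,
        normalizedSum (fun k ω => g (ξ k ω)) P n ω])
      atTop (id : EuclideanSpace ℝ (Fin 2) → EuclideanSpace ℝ (Fin 2)) (fun _ => P)
      (multivariateGaussian 0 (covMatrix (fun ω => f (ξ 0 ω)) (fun ω => g (ξ 0 ω)) P)) := by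
  have hmf : ∀ n, AEMeasurable (normalizedSum (fun k ω => f (ξ k ω)) P n) P := fun n =>
    (memLp_normalizedSum (ξ := fun k ω => f (ξ k ω)) (fun i => (hident i).comp hf) hfL n).aemeasurable
  have hmg : ∀ n, AEMeasurable (normalizedSum (fun k ω => g (ξ k ω)) P n) P := fun n =>
    (memLp_normalizedSum (ξ := fun k ω => g (ξ k ω)) (fun i => (hident i).comp hg) hgL n).aemeasurable
  have hm : ∀ n, AEMeasurable (fun ω => !₂[normalizedSum (fun k ω => f (ξ k ω)) P n ω,
      normalizedSum (fun k ω => g (ξ k ω)) P n ω]) P := by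
    intro n
    refine (WithLp.measurable_toLp 2 (Fin 2 → ℝ)).comp_aemeasurable (aemeasurable_pi_iff.2 fun i => ?_)
    fin_cases i
    · simpa using hmf n
    · simpa using hmg n
  refine ⟨hm, aemeasurable_id, ?_⟩
  refine ProbabilityMeasure.tendsto_iff_tendsto_charFun.2 fun t => ?_
  set ζ : ℕ → Ω → ℝ := fun k ω => t 0 * f (ξ k ω) + t 1 * g (ξ k ω) with hζ
  have hu : Measurable fun x : ℝ => t 0 * f x + t 1 * g x := by fun_prop
  have hζL : MemLp (ζ 0) 2 P := (hfL.const_mul (t 0)).add (hgL.const_mul (t 1))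
  have hclt := tendstoInDistribution_inv_sqrt_mul_sum_sub (P := P) (X := ζ)
    (P' := gaussianReal 0 Var[ζ 0; P].toNNReal) (Y := id) ⟨aemeasurable_id, Measure.map_id⟩ hζL
    (hindep.comp (fun _ x => t 0 * f x + t 1 * g x) fun _ => hu) (fun i => (hident i).comp hu)
  have hc := ProbabilityMeasure.tendsto_iff_tendsto_charFun.1 hclt.tendsto 1
  simp only [ProbabilityMeasure.coe_mk, Measure.map_id] at hc ⊢
  rw [charFun_multivariateGaussian (posSemidef_covMatrix hfL hgL)]
  rw [charFun_gaussianReal] at hc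
  have hv : ((Var[ζ 0; P].toNNReal : NNReal) : ℝ) = Var[ζ 0; P] :=
    Real.coe_toNNReal _ (variance_nonneg _ _)
  have hvar : Var[ζ 0; P] = t.ofLp ⬝ᵥ (covMatrix (fun ω => f (ξ 0 ω)) (fun ω => g (ξ 0 ω)) P).mulVec
      t.ofLp := by
    rw [hζ, variance_linear_combination hfL hgL]
    simp [covMatrix, Matrix.mulVec, dotProduct, Fin.sum_univ_two]
    ring
  rw [hv, hvar] at hc
  convert hc using 2
  · rename_i n
    rw [charFun_apply, charFun_apply, integral_map (hm n) (by fun_prop),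
      integral_map (hclt.forall_aemeasurable n) (by fun_prop)]
    congr 1 with ω
    have := normalizedSum_linear (ξ := fun k ω => f (ξ k ω)) (η := fun k ω => g (ξ k ω))
      (hfL.integrable one_le_two) (hgL.integrable one_le_two) (t 0) (t 1) n ω
    rw [show (√(n : ℝ))⁻¹ * (∑ k ∈ Finset.range n, ζ k ω - n * ∫ ω', ζ 0 ω' ∂P)
      = _ from this]
    congr 3
    simp [PiLp.inner_apply, Fin.sum_univ_two]
  · simp

end CentralLimit

/-! ### Asymptotically linear estimators -/

section AsymptoticallyLinear

variable {Ω : Type*} [MeasurableSpace Ω] {P : Measure Ω}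

/-- The estimator `T` of `θ`, computed from the sample `X`, is strongly consistent and
asymptotically linear with influence function `g`: up to a term tending to zero in probability,
`√n (T n - θ)` is the normalised sum of the variables `g (X k)`. The influence function is only
determined up to an additive constant, since `normalizedSum` centres it. -/
structure IsAsymptoticallyLinear (X : ℕ → Ω → ℝ) (P : Measure Ω) (T : ℕ → Ω → ℝ) (θ : ℝ)
    (g : ℝ → ℝ) : Prop where
  measurable : Measurable g
  memLp : MemLp (fun ω => g (X 0 ω)) 2 P
  aemeasurable : ∀ n, AEMeasurable (T n) P
  ae_tendsto : ∀ᵐ ω ∂P, Tendsto (fun n => T n ω) atTop (𝓝 θ)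
  remainder : TendstoInMeasure P
    (fun (n : ℕ) ω => √(n : ℝ) * (T n ω - θ) - normalizedSum (fun k ω => g (X k ω)) P n ω) atTop 0

variable {X : ℕ → Ω → ℝ}

lemma ae_tendsto_average (hindep : iIndepFun X P) (hident : ∀ i, IdentDistrib (X i) (X 0) P P)
    {g : ℝ → ℝ} (hg : Measurable g) (hgi : Integrable (fun ω => g (X 0 ω)) P) :
    ∀ᵐ ω ∂P, Tendsto (fun n : ℕ => (∑ k ∈ Finset.range n, g (X k ω)) / n) atTop
      (𝓝 (∫ ω, g (X 0 ω) ∂P)) :=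
  strong_law_ae_real (fun k ω => g (X k ω)) hgi
    (fun _ _ hij => (hindep.indepFun hij).comp hg hg) (fun i => (hident i).comp hg)

lemma sqrt_mul_average_sub (g : ℝ → ℝ) {n : ℕ} (hn : n ≠ 0) (ω : Ω) :
    √(n : ℝ) * ((∑ k ∈ Finset.range n, g (X k ω)) / n - ∫ ω', g (X 0 ω') ∂P)
      = normalizedSum (fun k ω => g (X k ω)) P n ω := by
  have hn' : (0 : ℝ) < n := by exact_mod_cast Nat.pos_of_ne_zero hn
  have hs : √(n : ℝ) * √(n : ℝ) = n := Real.mul_self_sqrt hn'.le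
  have hs0 : 0 < √(n : ℝ) := Real.sqrt_pos.2 hn'
  simp only [normalizedSum]
  rw [eq_inv_mul_iff_mul_eq₀ hs0.ne', ← mul_assoc, hs]
  field_simp

lemma MeasureTheory.TendstoInMeasure.congr_eventually_eq {f g : ℕ → Ω → ℝ}
    (hf : TendstoInMeasure P f atTop 0) (h : ∀ᶠ n in atTop, ∀ ω, f n ω = g n ω) :
    TendstoInMeasure P g atTop 0 :=
  hf.congr' (h.mono fun _ hn => ae_of_all _ hn) (ae_of_all _ fun _ => rfl)

variable [IsProbabilityMeasure P]

lemma memLp_normalizedSum_comp (hident : ∀ i, IdentDistrib (X i) (X 0) P P) {g : ℝ → ℝ}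
    {q : ENNReal} (hg : Measurable g) (hgL : MemLp (fun ω => g (X 0 ω)) q P) (n : ℕ) :
    MemLp (normalizedSum (fun k ω => g (X k ω)) P n) q P :=
  memLp_normalizedSum (ξ := fun k ω => g (X k ω)) (fun i => (hident i).comp hg) hgL n

lemma MeasureTheory.TendstoInMeasure.mul_normalizedSum (hindep : iIndepFun X P)
    (hident : ∀ i, IdentDistrib (X i) (X 0) P P) {g : ℝ → ℝ} (hg : Measurable g)
    (hgL : MemLp (fun ω => g (X 0 ω)) 2 P) {f : ℕ → Ω → ℝ} (hf : TendstoInMeasure P f atTop 0) :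
    TendstoInMeasure P (fun n ω => f n ω * normalizedSum (fun k ω => g (X k ω)) P n ω) atTop 0 :=
  hf.mul_of_integral_sq_le (memLp_normalizedSum_comp hident hg hgL)
    (integral_sq_normalizedSum_le (ξ := fun k ω => g (X k ω)) (hindep.comp (fun _ => g) fun _ => hg)
      (fun i => (hident i).comp hg) hgL)

lemma tendstoInMeasure_zero_of_tendsto {a : ℕ → ℝ} (ha : Tendsto a atTop (𝓝 0)) :
    TendstoInMeasure P (fun n (_ : Ω) => a n) atTop 0 :=
  tendstoInMeasure_of_tendsto_ae (fun _ => aestronglyMeasurable_const) (ae_of_all _ fun _ => ha)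

/-- An empirical mean is asymptotically linear, by the strong law of large numbers. -/
lemma isAsymptoticallyLinear_average (hindep : iIndepFun X P)
    (hident : ∀ i, IdentDistrib (X i) (X 0) P P) {g : ℝ → ℝ} (hg : Measurable g)
    (hgL : MemLp (fun ω => g (X 0 ω)) 2 P) :
    IsAsymptoticallyLinear X P (fun n ω => (∑ k ∈ Finset.range n, g (X k ω)) / n)
      (∫ ω, g (X 0 ω) ∂P) g where
  measurable := hg
  memLp := hgL
  aemeasurable n := (Finset.aemeasurable_fun_sum _ fun i _ =>
    hg.comp_aemeasurable (hident i).aemeasurable_fst).div_const _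
  ae_tendsto := ae_tendsto_average hindep hident hg (hgL.integrable one_le_two)
  remainder := by
    refine (tendstoInMeasure_zero_of_tendsto (P := P) tendsto_const_nhds).congr_eventually_eq ?_
    filter_upwards [eventually_ne_atTop 0] with n hn ω
    rw [sqrt_mul_average_sub g hn ω, sub_self]

lemma IsAsymptoticallyLinear.linear_combination {T S : ℕ → Ω → ℝ} {θ η : ℝ} {g h : ℝ → ℝ}
    (hT : IsAsymptoticallyLinear X P T θ g) (hS : IsAsymptoticallyLinear X P S η h) (a b : ℝ) :
    IsAsymptoticallyLinear X P (fun n ω => a * T n ω + b * S n ω) (a * θ + b * η)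
      (fun x => a * g x + b * h x) where
  measurable := (hT.measurable.const_mul a).add (hS.measurable.const_mul b)
  memLp := (hT.memLp.const_mul a).add (hS.memLp.const_mul b)
  aemeasurable n := ((hT.aemeasurable n).const_mul a).add ((hS.aemeasurable n).const_mul b)
  ae_tendsto := by
    filter_upwards [hT.ae_tendsto, hS.ae_tendsto] with ω h1 h2
    exact (h1.const_mul a).add (h2.const_mul b)
  remainder := by
    refine ((hT.remainder.const_mul_zero_real a).add_zero_real
      (hS.remainder.const_mul_zero_real b)).congr_eventually_eq (.of_forall fun n ω => ?_)
    have := normalizedSum_linear (ξ := fun k ω => g (X k ω)) (η := fun k ω => h (X k ω))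
      (hT.memLp.integrable one_le_two) (hS.memLp.integrable one_le_two) a b n ω
    rw [this]
    ring

/-- Adding an estimator of zero that is negligible at the scale `1 / √n` changes nothing. -/
lemma IsAsymptoticallyLinear.of_sub_negligible {T S : ℕ → Ω → ℝ} {θ : ℝ} {g : ℝ → ℝ}
    (hT : IsAsymptoticallyLinear X P T θ g) (hS : ∀ n, AEMeasurable (S n) P)
    (h : ∀ᵐ ω ∂P, Tendsto (fun n => S n ω - T n ω) atTop (𝓝 0))
    (h' : TendstoInMeasure P (fun (n : ℕ) ω => √(n : ℝ) * (S n ω - T n ω)) atTop 0) :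
    IsAsymptoticallyLinear X P S θ g where
  measurable := hT.measurable
  memLp := hT.memLp
  aemeasurable := hS
  ae_tendsto := by
    filter_upwards [h, hT.ae_tendsto] with ω h1 h2
    simpa using h1.add h2
  remainder := by
    refine (h'.add_zero_real hT.remainder).congr_eventually_eq (.of_forall fun n ω => ?_)
    ring

/-- The delta method: a differentiable transformation multiplies the influence function by the
derivative. -/
theorem IsAsymptoticallyLinear.delta_method (hindep : iIndepFun X P)
    (hident : ∀ i, IdentDistrib (X i) (X 0) P P) {T : ℕ → Ω → ℝ} {θ : ℝ} {g : ℝ → ℝ}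
    (hT : IsAsymptoticallyLinear X P T θ g) {h : ℝ → ℝ} (hh : Measurable h) {d : ℝ}
    (hd : HasDerivAt h d θ) :
    IsAsymptoticallyLinear X P (fun n ω => h (T n ω)) (h θ) (fun x => d * g x) where
  measurable := hT.measurable.const_mul d
  memLp := hT.memLp.const_mul d
  aemeasurable n := hh.comp_aemeasurable (hT.aemeasurable n)
  ae_tendsto := by
    filter_upwards [hT.ae_tendsto] with ω hω
    exact hd.continuousAt.tendsto.comp hω
  remainder := by
    -- the relative error of the linear approximation of `h` at `θ`; it vanishes at `θ`
    set e : ℝ → ℝ := fun x => (h x - h θ - d * (x - θ)) / (x - θ) with he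
    have hem : Measurable e := by fun_prop
    have he_mul : ∀ x, h x - h θ = d * (x - θ) + e x * (x - θ) := by
      intro x
      rcases eq_or_ne x θ with rfl | hx
      · simp
      · have : x - θ ≠ 0 := sub_ne_zero.2 hx
        simp only [he]
        field_simp
        ring
    have he0 : Tendsto e (𝓝 θ) (𝓝 0) := by
      have h1 := (hasDerivAt_iff_isLittleO.1 hd).tendsto_div_nhds_zero
      simpa [he, mul_comm] using h1
    have het : TendstoInMeasure P (fun n ω => e (T n ω)) atTop 0 := by
      refine tendstoInMeasure_of_tendsto_ae
        (fun n => (hem.comp_aemeasurable (hT.aemeasurable n)).aestronglyMeasurable) ?_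
      filter_upwards [hT.ae_tendsto] with ω hω
      exact he0.comp hω
    have h1 := het.mul_normalizedSum hindep hident hT.measurable hT.memLp
    have h2 := het.mul_zero_real hT.remainder
    refine ((h1.add_zero_real h2).add_zero_real
      (hT.remainder.const_mul_zero_real d)).congr_eventually_eq (.of_forall fun n ω => ?_)
    have := normalizedSum_linear (ξ := fun k ω => g (X k ω)) (η := fun k ω => g (X k ω))
      (hT.memLp.integrable one_le_two) (hT.memLp.integrable one_le_two) d 0 n ω
    simp only [zero_mul, add_zero] at this
    rw [this, he_mul]
    ring

/-- Two asymptotically linear estimators are jointly asymptotically normal; the limit covariance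
matrix is that of the influence functions. -/
theorem IsAsymptoticallyLinear.tendstoInDistribution_pair (hindep : iIndepFun X P)
    (hident : ∀ i, IdentDistrib (X i) (X 0) P P) {T S : ℕ → Ω → ℝ} {θ η : ℝ} {g h : ℝ → ℝ}
    (hT : IsAsymptoticallyLinear X P T θ g) (hS : IsAsymptoticallyLinear X P S η h) :
    TendstoInDistribution
      (fun (n : ℕ) (ω : Ω) => !₂[√(n : ℝ) * (T n ω - θ), √(n : ℝ) * (S n ω - η)])
      atTop (id : EuclideanSpace ℝ (Fin 2) → EuclideanSpace ℝ (Fin 2)) (fun _ => P)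
      (multivariateGaussian 0 (covMatrix (fun ω => g (X 0 ω)) (fun ω => h (X 0 ω)) P)) := by
  refine tendstoInDistribution_of_tendstoInMeasure_sub _ _
    (tendstoInDistribution_normalizedSum_pair hindep hident hT.measurable hS.measurable
      hT.memLp hS.memLp) ?_ fun n => ?_
  · rw [tendstoInMeasure_iff_measureReal_norm]
    intro ε hε
    have h1 := tendstoInMeasure_zero_iff.1 hT.remainder (ε / 2) (half_pos hε)
    have h2 := tendstoInMeasure_zero_iff.1 hS.remainder (ε / 2) (half_pos hε)
    refine tendsto_of_tendsto_of_tendsto_of_le_of_le tendsto_const_nhds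
      (by simpa using h1.add h2) (fun _ => measureReal_nonneg) fun n => ?_
    refine (measureReal_mono fun ω hω => ?_).trans (measureReal_union_le _ _)
    by_contra hc
    simp only [Set.mem_union, Set.mem_ofPred_eq, not_or, not_le] at hc hω
    have hsq : ‖!₂[√(n : ℝ) * (T n ω - θ), √(n : ℝ) * (S n ω - η)]
        - !₂[normalizedSum (fun k ω => g (X k ω)) P n ω,
          normalizedSum (fun k ω => h (X k ω)) P n ω]‖ < ε := by
      rw [EuclideanSpace.norm_eq, Real.sqrt_lt' hε]
      simp only [Fin.sum_univ_two, Real.norm_eq_abs]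
      simp
      have := sq_lt_sq' (by linarith [(abs_lt.1 hc.1).1]) (abs_lt.1 hc.1).2
      have := sq_lt_sq' (by linarith [(abs_lt.1 hc.2).1]) (abs_lt.1 hc.2).2
      nlinarith
    simp at hω
    linarith
  · refine (WithLp.measurable_toLp 2 (Fin 2 → ℝ)).comp_aemeasurable (aemeasurable_pi_iff.2 fun i => ?_)
    have := ((hT.aemeasurable n).sub_const θ).const_mul √(n : ℝ)
    have := ((hS.aemeasurable n).sub_const η).const_mul √(n : ℝ)
    fin_cases i <;> simpa

end AsymptoticallyLinear

/-! ### Sample mean and sample variance -/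

section MeanVariance

variable {Ω : Type*} [MeasurableSpace Ω] {P : Measure Ω} {X : ℕ → Ω → ℝ}

lemma average_sub_const (x : ℕ → ℝ) (m : ℝ) {n : ℕ} (hn : n ≠ 0) :
    (∑ j ∈ Finset.range n, (x j - m)) / n = sampleMean n x - m := by
  have : (n : ℝ) ≠ 0 := by exact_mod_cast hn
  simp only [sampleMean, Finset.sum_sub_distrib, Finset.sum_const, Finset.card_range, nsmul_eq_mul]
  field_simp

/-- Steiner's identity around an arbitrary centre `m`. For `n = 1` both sides are divided by zero
and hence zero. -/
lemma sampleVariance_eq (x : ℕ → ℝ) (m : ℝ) {n : ℕ} (hn : n ≠ 0) :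
    sampleVariance n x = n / ((n : ℝ) - 1) *
      ((∑ j ∈ Finset.range n, (x j - m) ^ 2) / n - (sampleMean n x - m) ^ 2) := by
  have hn' : (n : ℝ) ≠ 0 := by exact_mod_cast hn
  have h1 : ∑ j ∈ Finset.range n, (x j - m) = n * (sampleMean n x - m) := by
    rw [← average_sub_const x m hn]; field_simp
  have h2 : ∑ j ∈ Finset.range n, (x j - sampleMean n x) ^ 2
      = ∑ j ∈ Finset.range n, (x j - m) ^ 2 - n * (sampleMean n x - m) ^ 2 := by
    have : ∀ j, (x j - sampleMean n x) ^ 2 = (x j - m) ^ 2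
        - 2 * (sampleMean n x - m) * (x j - m) + (sampleMean n x - m) ^ 2 := fun j => by ring
    simp_rw [this]
    rw [Finset.sum_add_distrib, Finset.sum_sub_distrib, ← Finset.mul_sum, h1]
    simp
    ring
  rw [sampleVariance, h2]
  field_simp

lemma aemeasurable_sampleMean (hX : ∀ i, AEMeasurable (X i) P) (n : ℕ) :
    AEMeasurable (fun ω => sampleMean n (fun j => X j ω)) P :=
  (Finset.aemeasurable_fun_sum _ fun i _ => hX i).div_const _

lemma aemeasurable_sampleVariance (hX : ∀ i, AEMeasurable (X i) P) (n : ℕ) :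
    AEMeasurable (fun ω => sampleVariance n (fun j => X j ω)) P :=
  (Finset.aemeasurable_fun_sum _ fun i _ =>
    ((hX i).sub (aemeasurable_sampleMean hX n)).pow_const 2).div_const _

lemma aemeasurable_sampleMAD (hX : ∀ i, AEMeasurable (X i) P) (n : ℕ) :
    AEMeasurable (fun ω => sampleMAD n (fun j => X j ω)) P :=
  (Finset.aemeasurable_fun_sum _ fun i _ =>
    ((hX i).sub (aemeasurable_sampleMean hX n)).norm).div_const _

lemma tendsto_natCast_div_sub_one : Tendsto (fun n : ℕ => (n : ℝ) / ((n : ℝ) - 1)) atTop (𝓝 1) := by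
  simpa [sub_eq_add_neg] using tendsto_natCast_div_add_atTop (-1 : ℝ)

lemma tendsto_inv_sqrt_natCast : Tendsto (fun n : ℕ => (√(n : ℝ))⁻¹) atTop (𝓝 0) :=
  tendsto_inv_atTop_zero.comp (Real.tendsto_sqrt_atTop.comp tendsto_natCast_atTop_atTop)

lemma sqrt_mul_sampleMean_sub {n : ℕ} (hn : n ≠ 0) (ω : Ω) :
    √(n : ℝ) * (sampleMean n (fun j => X j ω) - P[X 0]) = normalizedSum X P n ω :=
  sqrt_mul_average_sub (fun x => x) hn ω

variable [IsProbabilityMeasure P]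

lemma isAsymptoticallyLinear_sampleMean (hindep : iIndepFun X P)
    (hident : ∀ i, IdentDistrib (X i) (X 0) P P) (hL : MemLp (X 0) 2 P) :
    IsAsymptoticallyLinear X P (fun n ω => sampleMean n (fun j => X j ω)) P[X 0] (fun x => x) :=
  isAsymptoticallyLinear_average hindep hident measurable_id hL

/-- The sample variance is asymptotically linear. The term `√n (X̄ - μ)²` coming from the
estimation of the mean is negligible. -/
theorem isAsymptoticallyLinear_sampleVariance (hindep : iIndepFun X P)
    (hident : ∀ i, IdentDistrib (X i) (X 0) P P) (hL : MemLp (X 0) 4 P) :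
    IsAsymptoticallyLinear X P (fun n ω => sampleVariance n (fun j => X j ω)) Var[X 0; P]
      (fun x => (x - P[X 0]) ^ 2) := by
  set m := P[X 0] with hm
  have hX : ∀ i, AEMeasurable (X i) P := fun i => (hident i).aemeasurable_fst
  have hL2 : MemLp (X 0) 2 P := hL.mono_exponent (by norm_num)
  have hsq : MemLp (fun ω => (X 0 ω - m) ^ 2) 2 P := (hL.sub (memLp_const m)).sq_of_four
  have hT := isAsymptoticallyLinear_average hindep hident
    (g := fun x => (x - m) ^ 2) (by fun_prop) hsq
  have hM := isAsymptoticallyLinear_sampleMean hindep hident hL2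
  rw [variance_eq_integral (hX 0)]
  set T : ℕ → Ω → ℝ := fun n ω => (∑ k ∈ Finset.range n, (X k ω - m) ^ 2) / n with hT_def
  set D : ℕ → Ω → ℝ := fun n ω => sampleMean n (fun j => X j ω) - m with hD_def
  have hD : ∀ᵐ ω ∂P, Tendsto (fun n => D n ω) atTop (𝓝 0) := by
    filter_upwards [hM.ae_tendsto] with ω hω
    have := hω.sub_const m
    rwa [← hm, sub_self] at this
  have ha : Tendsto (fun n : ℕ => (n : ℝ) / ((n : ℝ) - 1) - 1) atTop (𝓝 0) := by
    simpa using tendsto_natCast_div_sub_one.sub_const 1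
  have hdiff : ∀ {n : ℕ}, n ≠ 0 → ∀ ω, sampleVariance n (fun j => X j ω) - T n ω
      = ((n : ℝ) / ((n : ℝ) - 1) - 1) * T n ω - n / ((n : ℝ) - 1) * D n ω ^ 2 := by
    intro n hn ω
    rw [sampleVariance_eq _ m hn]
    ring
  have hTm : ∀ n, AEMeasurable (T n) P := hT.aemeasurable
  have hDm : ∀ n, AEMeasurable (D n) P := fun n => (hM.aemeasurable n).sub_const m
  refine hT.of_sub_negligible (aemeasurable_sampleVariance hX) ?_ ?_
  · filter_upwards [hT.ae_tendsto, hD] with ω h1 h2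
    have := (ha.mul h1).sub (tendsto_natCast_div_sub_one.mul (h2.pow 2))
    simp only [zero_mul, ne_eq, OfNat.ofNat_ne_zero, not_false_eq_true, zero_pow, mul_zero,
      sub_zero] at this
    refine this.congr' ?_
    filter_upwards [eventually_ne_atTop 0] with n hn
    exact (hdiff hn ω).symm
  · -- `h1` treats the normalisation `1 / (n - 1)` instead of `1 / n`, `h2` the squared error of
    -- the sample mean, written as `D n` times a normalised sum
    have h1 : TendstoInMeasure P (fun (n : ℕ) ω => (n : ℝ) / ((n : ℝ) - 1) * (√(n : ℝ))⁻¹ * T n ω)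
        atTop 0 := by
      refine tendstoInMeasure_of_tendsto_ae
        (fun n => ((hTm n).const_mul _).aestronglyMeasurable) ?_
      filter_upwards [hT.ae_tendsto] with ω h
      simpa using (tendsto_natCast_div_sub_one.mul tendsto_inv_sqrt_natCast).mul h
    have h2 : TendstoInMeasure P (fun (n : ℕ) ω => -((n : ℝ) / ((n : ℝ) - 1)) * D n ω) atTop 0 := by
      refine tendstoInMeasure_of_tendsto_ae
        (fun n => ((hDm n).const_mul _).aestronglyMeasurable) ?_
      filter_upwards [hD] with ω h
      simpa using tendsto_natCast_div_sub_one.neg.mul h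
    refine (h1.add_zero_real
      (h2.mul_normalizedSum hindep hident measurable_id hL2)).congr_eventually_eq ?_
    filter_upwards [eventually_ge_atTop 2] with n hn ω
    have hn0 : n ≠ 0 := by omega
    have hn2 : (2 : ℝ) ≤ n := by exact_mod_cast hn
    have hn1 : (n : ℝ) - 1 ≠ 0 := by linarith
    have hs : √(n : ℝ) * √(n : ℝ) = n := Real.mul_self_sqrt (by linarith)
    have hs0 : √(n : ℝ) ≠ 0 := (Real.sqrt_pos.2 (by linarith)).ne'
    rw [hdiff hn0, show normalizedSum (fun k ω => id (X k ω)) P n ω = √(n : ℝ) * D n ω from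
      (sqrt_mul_sampleMean_sub hn0 ω).symm]
    have e : (n : ℝ) / ((n : ℝ) - 1) * (√(n : ℝ))⁻¹ = √(n : ℝ) * ((n : ℝ) / ((n : ℝ) - 1) - 1) := by
      field_simp
      rw [sq, hs]
      ring
    rw [e]
    ring

/-- Influence function of the location-scale quantile estimator, where `m` and `s` stand for the
mean and the standard deviation, and `q` for the quantile of the standardised law. -/
noncomputable def quantileInfluence (q m s x : ℝ) : ℝ := x + q * (1 / (2 * s) * (x - m) ^ 2)

/-- The location-scale quantile estimator is asymptotically linear; the sample standard deviation
is handled by the delta method for the square root. -/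
lemma isAsymptoticallyLinear_locScaleQuantile (hindep : iIndepFun X P)
    (hident : ∀ i, IdentDistrib (X i) (X 0) P P) (hL : MemLp (X 0) 4 P) (hσ : 0 < Var[X 0; P])
    (q : ℝ) :
    IsAsymptoticallyLinear X P (fun n ω => locScaleQuantile q n (fun j => X j ω))
      (P[X 0] + stdDev (X 0) P * q)
      (quantileInfluence q P[X 0] (stdDev (X 0) P)) := by
  have hS := (isAsymptoticallyLinear_sampleVariance hindep hident hL).delta_method hindep hident
    Real.continuous_sqrt.measurable (Real.hasDerivAt_sqrt hσ.ne')
  have := (isAsymptoticallyLinear_sampleMean hindep hident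
    (hL.mono_exponent (by norm_num))).linear_combination hS 1 q
  have e : quantileInfluence q P[X 0] (stdDev (X 0) P)
      = fun x => x + q * (1 / (2 * stdDev (X 0) P) * (x - P[X 0]) ^ 2) := rfl
  rw [e]
  simpa [locScaleQuantile, stdDev, mul_comm q] using this

end MeanVariance

/-! ### Sample mean absolute deviation -/

section MeanAbsoluteDeviation

variable {Ω : Type*} [MeasurableSpace Ω] {P : Measure Ω} {X : ℕ → Ω → ℝ}

/-- First order expansion of `|x - m - δ|` in `δ`; the error vanishes unless `x` lies within `|δ|`
of the kink `m`. -/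
lemma abs_abs_sub_sub_le {x m δ η : ℝ} (hδ : |δ| ≤ η) :
    |(|x - m - δ| - |x - m|) - δ * (2 * (Set.Iic m).indicator (fun _ => 1) x - 1)|
      ≤ |δ| * (2 * (Set.Icc (m - η) (m + η)).indicator (fun _ => 1) x) := by
  have hδ1 := abs_le.1 (le_refl |δ|)
  by_cases hx : x ∈ Set.Icc (m - η) (m + η)
  · rw [Set.indicator_of_mem hx]
    have h1 : |(|x - m - δ| - |x - m|)| ≤ |δ| := by
      refine (abs_abs_sub_abs_le _ _).trans ?_
      simp
    have h2 : |δ * (2 * (Set.Iic m).indicator (fun _ => (1 : ℝ)) x - 1)| ≤ |δ| := by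
      rw [abs_mul]
      by_cases hm : x ∈ Set.Iic m
      · rw [Set.indicator_of_mem hm]; norm_num
      · rw [Set.indicator_of_notMem hm]; norm_num
    refine (abs_sub _ _).trans ?_
    linarith
  · rw [Set.indicator_of_notMem hx]
    simp only [mul_zero, abs_nonpos_iff]
    rw [Set.mem_Icc, not_and_or, not_le, not_le] at hx
    rcases hx with hx | hx
    · rw [Set.indicator_of_mem (show x ∈ Set.Iic m by simp; linarith [abs_nonneg δ]),
        abs_of_neg (by linarith : x - m - δ < 0), abs_of_neg (by linarith [abs_nonneg δ] : x - m < 0)]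
      ring
    · rw [Set.indicator_of_notMem (show x ∉ Set.Iic m by simp; linarith [abs_nonneg δ]),
        abs_of_pos (by linarith : 0 < x - m - δ), abs_of_pos (by linarith [abs_nonneg δ] : 0 < x - m)]
      ring

/-- Averaged form of `abs_abs_sub_sub_le`. With `c = 2 F(m) - 1` both terms in the last factor are
small for large samples and small `η`. -/
lemma abs_sampleMAD_sub_le (x : ℕ → ℝ) (m c η : ℝ) {n : ℕ} (hn : n ≠ 0)
    (hδ : |sampleMean n x - m| ≤ η) :
    |sampleMAD n x - (∑ j ∈ Finset.range n, |x j - m|) / n - c * (sampleMean n x - m)|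
      ≤ |sampleMean n x - m| *
        (|2 * ((∑ j ∈ Finset.range n, (Set.Iic m).indicator (fun _ => (1 : ℝ)) (x j)) / n) - 1 - c|
          + 2 * ((∑ j ∈ Finset.range n,
            (Set.Icc (m - η) (m + η)).indicator (fun _ => (1 : ℝ)) (x j)) / n)) := by
  have hn' : (0 : ℝ) < n := by exact_mod_cast Nat.pos_of_ne_zero hn
  set δ := sampleMean n x - m with hδ_def
  set A : ℕ → ℝ := fun j => (Set.Iic m).indicator (fun _ => (1 : ℝ)) (x j)
  set B : ℕ → ℝ := fun j => (Set.Icc (m - η) (m + η)).indicator (fun _ => (1 : ℝ)) (x j)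
  have hsum : |∑ j ∈ Finset.range n, ((|x j - m - δ| - |x j - m|) - δ * (2 * A j - 1))|
      ≤ ∑ j ∈ Finset.range n, |δ| * (2 * B j) :=
    (Finset.abs_sum_le_sum_abs _ _).trans (Finset.sum_le_sum fun j _ => abs_abs_sub_sub_le hδ)
  have e : sampleMAD n x - (∑ j ∈ Finset.range n, |x j - m|) / n - c * δ
      = (∑ j ∈ Finset.range n, ((|x j - m - δ| - |x j - m|) - δ * (2 * A j - 1))) / n
        + δ * (2 * ((∑ j ∈ Finset.range n, A j) / n) - 1 - c) := by
    have : ∀ j, |x j - sampleMean n x| = |x j - m - δ| := fun j => by rw [hδ_def]; congr 1; ring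
    simp only [sampleMAD, this, Finset.sum_sub_distrib, ← Finset.mul_sum, Finset.sum_const,
      Finset.card_range, nsmul_eq_mul]
    field_simp
    ring
  rw [e]
  refine (abs_add_le _ _).trans ?_
  rw [abs_mul, abs_div, abs_of_pos hn']
  have h2 : |∑ j ∈ Finset.range n, ((|x j - m - δ| - |x j - m|) - δ * (2 * A j - 1))| / n
      ≤ |δ| * (2 * ((∑ j ∈ Finset.range n, B j) / n)) := by
    rw [div_le_iff₀ hn']
    refine hsum.trans (le_of_eq ?_)
    rw [← Finset.mul_sum, ← Finset.mul_sum]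
    field_simp
  linarith

lemma integral_indicator_one_comp {Y : Ω → ℝ} (hY : AEMeasurable Y P) {S : Set ℝ}
    (hS : MeasurableSet S) :
    ∫ ω, S.indicator (fun _ => (1 : ℝ)) (Y ω) ∂P = (P.map Y).real S := by
  rw [← integral_map (f := S.indicator fun _ => (1 : ℝ)) hY
    ((measurable_const.indicator hS).aestronglyMeasurable), integral_indicator_const _ hS]
  simp

variable [IsProbabilityMeasure P]

lemma distFun_eq_real {Y : Ω → ℝ} (hY : AEMeasurable Y P) (x : ℝ) :
    distFun Y P x = (P.map Y).real (Set.Iic x) := by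
  have := Measure.isProbabilityMeasure_map hY
  exact cdf_eq_real _ _

/-- Where the distribution function is continuous, small balls have small probability. -/
lemma exists_real_Icc_lt_of_continuousAt {Y : Ω → ℝ} (hY : AEMeasurable Y P) {m : ℝ}
    (hc : ContinuousAt (distFun Y P) m) {ε : ℝ} (hε : 0 < ε) :
    ∃ η > 0, (P.map Y).real (Set.Icc (m - η) (m + η)) < ε := by
  have := Measure.isProbabilityMeasure_map hY
  obtain ⟨δ, hδ, h⟩ := Metric.continuousAt_iff.1 hc (ε / 2) (half_pos hε)
  refine ⟨δ / 3, by positivity, ?_⟩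
  have h1 := h (x := m + δ / 3) (by rw [Real.dist_eq, abs_lt]; constructor <;> linarith)
  have h2 := h (x := m - 2 * (δ / 3)) (by rw [Real.dist_eq, abs_lt]; constructor <;> linarith)
  rw [Real.dist_eq, abs_lt, distFun_eq_real hY, distFun_eq_real hY] at h1 h2
  have h3 : (P.map Y).real (Set.Icc (m - δ / 3) (m + δ / 3))
      ≤ (P.map Y).real (Set.Iic (m + δ / 3) \ Set.Iic (m - 2 * (δ / 3))) :=
    measureReal_mono fun x hx => ⟨hx.2, by simp; linarith [hx.1]⟩
  rw [measureReal_sdiff (Set.Iic_subset_Iic.2 (by linarith)) measurableSet_Iic] at h3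
  linarith

/-- The sample mean absolute deviation is asymptotically linear if the mean is not an atom. Its
dependence on the estimated mean contributes `(2 F(μ) - 1) x` to the influence function. -/
theorem isAsymptoticallyLinear_sampleMAD (hindep : iIndepFun X P)
    (hident : ∀ i, IdentDistrib (X i) (X 0) P P) (hL : MemLp (X 0) 2 P)
    (hc : ContinuousAt (distFun (X 0) P) P[X 0]) :
    IsAsymptoticallyLinear X P (fun n ω => sampleMAD n (fun j => X j ω)) (∫ ω, |X 0 ω - P[X 0]| ∂P)
      (fun x => |x - P[X 0]| + (2 * distFun (X 0) P P[X 0] - 1) * (x - P[X 0])) := by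
  set m := P[X 0] with hm
  set c := 2 * distFun (X 0) P m - 1 with hc_def
  have hX : ∀ i, AEMeasurable (X i) P := fun i => (hident i).aemeasurable_fst
  have hLm : MemLp (fun ω => X 0 ω - m) 2 P := hL.sub (memLp_const m)
  have hT := (isAsymptoticallyLinear_average hindep hident (g := fun x => |x - m|) (by fun_prop)
    hLm.norm).linear_combination
    (isAsymptoticallyLinear_average hindep hident (g := fun x => x - m) (by fun_prop) hLm) 1 c
  have hm0 : ∫ ω, (X 0 ω - m) ∂P = 0 := by
    rw [integral_sub (hL.integrable one_le_two) (integrable_const _)]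
    simp [hm]
  simp only [hm0, mul_zero, add_zero, one_mul] at hT
  set D : ℕ → Ω → ℝ := fun n ω => sampleMean n (fun j => X j ω) - m with hD_def
  set R : ℕ → Ω → ℝ := fun n ω => sampleMAD n (fun j => X j ω)
    - ((∑ k ∈ Finset.range n, |X k ω - m|) / n + c * ((∑ k ∈ Finset.range n, (X k ω - m)) / n))
    with hR_def
  have hDm : ∀ n, AEMeasurable (D n) P := fun n => (aemeasurable_sampleMean hX n).sub_const m
  have hRm : ∀ n, AEMeasurable (R n) P := fun n =>
    (aemeasurable_sampleMAD hX n).sub (hT.aemeasurable n)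
  have hD : ∀ᵐ ω ∂P, Tendsto (fun n => D n ω) atTop (𝓝 0) := by
    filter_upwards [(isAsymptoticallyLinear_sampleMean hindep hident hL).ae_tendsto] with ω hω
    have := hω.sub_const m
    rwa [← hm, sub_self] at this
  have hRle : ∀ {n : ℕ}, n ≠ 0 → ∀ ω η, |D n ω| ≤ η → |R n ω| ≤ |D n ω| *
        (|2 * ((∑ j ∈ Finset.range n, (Set.Iic m).indicator (fun _ => (1 : ℝ)) (X j ω)) / n) - 1 - c|
          + 2 * ((∑ j ∈ Finset.range n,
            (Set.Icc (m - η) (m + η)).indicator (fun _ => (1 : ℝ)) (X j ω)) / n)) := by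
    intro n hn ω η h
    have := abs_sampleMAD_sub_le (fun j => X j ω) m c η hn h
    rw [hR_def]
    simp only
    rw [average_sub_const (fun j => X j ω) m hn]
    simpa only [sub_sub] using this
  -- the remainder is `o(D n)` almost surely
  have hκ : ∀ᵐ ω ∂P, Tendsto (fun n => R n ω / D n ω) atTop (𝓝 0) := by
    have hη : ∀ k : ℕ, ∃ η > 0, (P.map (X 0)).real (Set.Icc (m - η) (m + η)) < 1 / ((k : ℝ) + 1) :=
      fun k => exists_real_Icc_lt_of_continuousAt (hX 0) hc (by positivity)
    choose η hη0 hη using hη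
    have hint : ∀ S : Set ℝ, MeasurableSet S →
        Integrable (fun ω => S.indicator (fun _ => (1 : ℝ)) (X 0 ω)) P := fun S hS =>
      Integrable.of_bound ((measurable_const.indicator hS).comp_aemeasurable (hX 0)).aestronglyMeasurable
        1 (ae_of_all _ fun ω => by
          by_cases h : X 0 ω ∈ S <;> simp [h])
    have hI := ae_tendsto_average hindep hident (g := (Set.Iic m).indicator fun _ => (1 : ℝ))
      (measurable_const.indicator measurableSet_Iic) (hint _ measurableSet_Iic)
    have hJ : ∀ᵐ ω ∂P, ∀ k : ℕ, Tendsto (fun n : ℕ => (∑ j ∈ Finset.range n,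
        (Set.Icc (m - η k) (m + η k)).indicator (fun _ => (1 : ℝ)) (X j ω)) / n) atTop
        (𝓝 ((P.map (X 0)).real (Set.Icc (m - η k) (m + η k)))) := by
      refine ae_all_iff.2 fun k => ?_
      have := ae_tendsto_average hindep hident
        (g := (Set.Icc (m - η k) (m + η k)).indicator fun _ => (1 : ℝ))
        (measurable_const.indicator measurableSet_Icc) (hint _ measurableSet_Icc)
      rwa [integral_indicator_one_comp (hX 0) measurableSet_Icc] at this
    rw [integral_indicator_one_comp (hX 0) measurableSet_Iic, ← distFun_eq_real (hX 0)] at hI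
    filter_upwards [hD, hI, hJ] with ω h1 h2 h3
    rw [Metric.tendsto_atTop]
    intro ε hε
    obtain ⟨k, hk⟩ := exists_nat_one_div_lt (show 0 < ε / 4 by positivity)
    have h4 : Tendsto (fun n : ℕ => |2 * ((∑ j ∈ Finset.range n,
        (Set.Iic m).indicator (fun _ => (1 : ℝ)) (X j ω)) / n) - 1 - c|) atTop (𝓝 0) := by
      have := (((h2.const_mul 2).sub_const 1).sub_const c).abs
      simpa [hc_def] using this
    have e1 := h4.eventually_lt_const (show 0 < ε / 2 by positivity)
    have e2 := (h3 k).eventually_lt_const ((hη k).trans hk)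
    have e3 := (tendsto_zero_iff_abs_tendsto_zero _).1 h1 |>.eventually_lt_const (hη0 k)
    obtain ⟨N, hN⟩ := eventually_atTop.1 (e1.and (e2.and (e3.and (eventually_ne_atTop 0))))
    refine ⟨N, fun n hn => ?_⟩
    obtain ⟨f1, f2, f3, f4⟩ := hN n hn
    have hle := hRle f4 ω (η k) (le_of_lt f3)
    rw [dist_zero_right, Real.norm_eq_abs, abs_div]
    refine (div_le_of_le_mul₀ (abs_nonneg _) ?_ (hle.trans_eq (mul_comm _ _))).trans_lt ?_
    · exact (abs_nonneg (R n ω)).trans hle |> fun h => by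
        have : (0 : ℝ) ≤ (∑ j ∈ Finset.range n,
            (Set.Icc (m - η k) (m + η k)).indicator (fun _ => (1 : ℝ)) (X j ω)) / n :=
          div_nonneg (Finset.sum_nonneg fun j _ => Set.indicator_nonneg (by simp) _) (by positivity)
        positivity
    · linarith
  -- where `D n` vanishes the quotient is zero by convention, but then `R n` vanishes as well
  have hRD : ∀ {n : ℕ}, n ≠ 0 → ∀ ω, R n ω = R n ω / D n ω * D n ω := by
    intro n hn ω
    rcases eq_or_ne (D n ω) 0 with h0 | h0
    · have := hRle hn ω 0 (by simp [h0])
      rw [h0, abs_zero, zero_mul, abs_nonpos_iff] at this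
      simp [this]
    · field_simp
  refine hT.of_sub_negligible (aemeasurable_sampleMAD hX) ?_ ?_
  · filter_upwards [hκ, hD] with ω h1 h2
    have := h1.mul h2
    rw [mul_zero] at this
    refine this.congr' ?_
    filter_upwards [eventually_ne_atTop 0] with n hn
    exact (hRD hn ω).symm
  · have h1 : TendstoInMeasure P (fun n ω => R n ω / D n ω) atTop 0 :=
      tendstoInMeasure_of_tendsto_ae (fun n => ((hRm n).div (hDm n)).aestronglyMeasurable) hκ
    refine (h1.mul_normalizedSum hindep hident measurable_id hL).congr_eventually_eq ?_
    filter_upwards [eventually_ne_atTop 0] with n hn ω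
    rw [show normalizedSum (fun k ω => id (X k ω)) P n ω = √(n : ℝ) * D n ω from
      (sqrt_mul_sampleMean_sub hn ω).symm]
    change _ = √(n : ℝ) * R n ω
    rw [hRD hn ω]
    field_simp

end MeanAbsoluteDeviation

/-! ### Uniform integrability of the squared errors -/

section ErrorIntegrability

variable {Ω : Type*} [MeasurableSpace Ω] {P : Measure Ω} {X : ℕ → Ω → ℝ}

/-- Near `θ` the bound comes from the derivative, away from `θ` from the linear growth. -/
lemma exists_forall_abs_sub_le_of_hasDerivAt {h : ℝ → ℝ} {d θ C : ℝ} (hd : HasDerivAt h d θ)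
    (hC : ∀ x, |h x| ≤ C * (1 + |x|)) : ∃ L : ℝ, ∀ x, |h x - h θ| ≤ L * |x - θ| := by
  obtain ⟨L, hL⟩ := hd.isBigO_sub.bound
  obtain ⟨δ, hδ, hball⟩ := Metric.eventually_nhds_iff.1 hL
  have hC0 : 0 ≤ C := by
    have := (abs_nonneg _).trans (hC 0)
    simpa using this
  refine ⟨|L| + (C + (C * (1 + |θ|) + |h θ|) / δ), fun x => ?_⟩
  have h2 : 0 ≤ C + (C * (1 + |θ|) + |h θ|) / δ := by positivity
  rcases lt_or_ge (|x - θ|) δ with hx | hx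
  · have h1 : |h x - h θ| ≤ L * |x - θ| := hball (by rwa [Real.dist_eq])
    nlinarith [le_abs_self L, abs_nonneg (x - θ)]
  · have h1 : |h x - h θ| ≤ C * (1 + |x|) + |h θ| := (abs_sub _ _).trans (by linarith [hC x])
    have h3 : |x| ≤ |x - θ| + |θ| := by simpa using abs_add_le (x - θ) θ
    have h4 : C * (1 + |θ|) + |h θ| ≤ (C * (1 + |θ|) + |h θ|) / δ * |x - θ| := by
      rw [div_mul_eq_mul_div, le_div_iff₀ hδ]
      exact mul_le_mul_of_nonneg_left hx (by positivity)
    nlinarith [mul_nonneg (abs_nonneg L) (abs_nonneg (x - θ))]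

/-- A transformation of at most linear growth that is differentiable at `θ` preserves uniform
integrability of the squared normalised errors, since it is Lipschitz at `θ`. -/
lemma EventuallySqUnifIntegrable.comp_linear_growth {T : ℕ → Ω → ℝ} {θ : ℝ}
    (hT : EventuallySqUnifIntegrable (fun (n : ℕ) ω => √(n : ℝ) * (T n ω - θ)) P)
    (hTm : ∀ n, AEMeasurable (T n) P) {h : ℝ → ℝ} (hh : Measurable h) {d C : ℝ}
    (hd : HasDerivAt h d θ) (hC : ∀ x, |h x| ≤ C * (1 + |x|)) :
    EventuallySqUnifIntegrable (fun (n : ℕ) ω => √(n : ℝ) * (h (T n ω) - h θ)) P := by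
  obtain ⟨L, hL⟩ := exists_forall_abs_sub_le_of_hasDerivAt hd hC
  refine (hT.const_mul L).of_eventually_le (fun n =>
    (((hh.comp_aemeasurable (hTm n)).sub_const _).const_mul _).aestronglyMeasurable)
    (.of_forall fun n ω => ?_)
  rw [mul_left_comm, abs_mul, abs_mul _ (L * _), abs_mul L]
  refine mul_le_mul_of_nonneg_left ((hL _).trans ?_) (abs_nonneg _)
  exact mul_le_mul_of_nonneg_right (le_abs_self L) (abs_nonneg _)

lemma EventuallySqUnifIntegrable.abs {U : ℕ → Ω → ℝ} (hU : EventuallySqUnifIntegrable U P)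
    (hm : ∀ n, AEStronglyMeasurable (U n) P) :
    EventuallySqUnifIntegrable (fun n ω => |U n ω|) P :=
  hU.of_eventually_le (fun n => (hm n).norm) (.of_forall fun _ _ => (abs_abs _).le)

variable [IsProbabilityMeasure P]

lemma eventuallySqUnifIntegrable_normalizedSum_comp (hindep : iIndepFun X P)
    (hident : ∀ i, IdentDistrib (X i) (X 0) P P) {g : ℝ → ℝ} (hg : Measurable g)
    (hgL : MemLp (fun ω => g (X 0 ω)) 2 P) :
    EventuallySqUnifIntegrable (normalizedSum (fun k ω => g (X k ω)) P) P :=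
  (uniformIntegrable_normalizedSum (ξ := fun k ω => g (X k ω)) (hindep.comp (fun _ => g) fun _ => hg)
    (fun i => (hident i).comp hg) hgL).eventuallySqUnifIntegrable

lemma eventuallySqUnifIntegrable_sampleMean (hindep : iIndepFun X P)
    (hident : ∀ i, IdentDistrib (X i) (X 0) P P) (hL : MemLp (X 0) 2 P) :
    EventuallySqUnifIntegrable
      (fun (n : ℕ) ω => √(n : ℝ) * (sampleMean n (fun j => X j ω) - P[X 0])) P := by
  refine (eventuallySqUnifIntegrable_normalizedSum_comp hindep hident measurable_id
    hL).of_eventually_le (fun n => (((aemeasurable_sampleMean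
      (fun i => (hident i).aemeasurable_fst) n).sub_const _).const_mul _).aestronglyMeasurable) ?_
  filter_upwards [eventually_ne_atTop 0] with n hn ω
  rw [sqrt_mul_sampleMean_sub hn]
  rfl

/-- With `Z` and `W` the normalised sums of `X` and of `(X - μ) ^ 2`, the normalised error of the
sample variance is at most `2 (|W| + Z ^ 2 / √n + σ ^ 2)`. -/
lemma eventuallySqUnifIntegrable_sampleVariance (hindep : iIndepFun X P)
    (hident : ∀ i, IdentDistrib (X i) (X 0) P P) (hL : MemLp (X 0) 4 P) :
    EventuallySqUnifIntegrable
      (fun (n : ℕ) ω => √(n : ℝ) * (sampleVariance n (fun j => X j ω) - Var[X 0; P])) P := by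
  set m := P[X 0] with hm
  have hX : ∀ i, AEMeasurable (X i) P := fun i => (hident i).aemeasurable_fst
  have hsq : MemLp (fun ω => (X 0 ω - m) ^ 2) 2 P := (hL.sub (memLp_const m)).sq_of_four
  have hg : Measurable fun x : ℝ => (x - m) ^ 2 := by fun_prop
  have h1 := (eventuallySqUnifIntegrable_normalizedSum_comp hindep hident hg hsq).abs
    fun n => (memLp_normalizedSum_comp hident hg hsq n).aestronglyMeasurable
  have h2 := (uniformIntegrable_sq_normalizedSum_div_sqrt hindep hident hL).eventuallySqUnifIntegrable
  have h3 := eventuallySqUnifIntegrable_const (P := P) Var[X 0; P]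
  have hv : 0 ≤ Var[X 0; P] := variance_nonneg _ _
  refine (((h1.add h2).add h3).const_mul 2).of_eventually_le (fun n => (((aemeasurable_sampleVariance
    hX n).sub_const _).const_mul _).aestronglyMeasurable) ?_
  filter_upwards [eventually_ge_atTop 2] with n hn ω
  have hn0 : n ≠ 0 := by omega
  have hn2 : (2 : ℝ) ≤ n := by exact_mod_cast hn
  have hn1 : (0 : ℝ) < (n : ℝ) - 1 := by linarith
  have hs : √(n : ℝ) * √(n : ℝ) = n := Real.mul_self_sqrt (by linarith)
  have hs1 : 1 ≤ √(n : ℝ) := Real.one_le_sqrt.2 (by linarith)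
  have hs0 : √(n : ℝ) ≠ 0 := by positivity
  set Z := normalizedSum X P n ω
  set W := normalizedSum (fun k ω => (X k ω - m) ^ 2) P n ω with hW
  have hZ : sampleMean n (fun j => X j ω) - m = Z / √(n : ℝ) := by
    rw [eq_div_iff hs0, mul_comm]; exact sqrt_mul_sampleMean_sub hn0 ω
  have hWv : (∑ j ∈ Finset.range n, (X j ω - m) ^ 2) / n = Var[X 0; P] + W / √(n : ℝ) := by
    rw [variance_eq_integral (hX 0), hW, ← sqrt_mul_average_sub (fun x => (x - m) ^ 2) hn0 ω]
    field_simp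
    ring
  have e : √(n : ℝ) * (sampleVariance n (fun j => X j ω) - Var[X 0; P])
      = n / ((n : ℝ) - 1) * (W - Z ^ 2 / √(n : ℝ)) + √(n : ℝ) / ((n : ℝ) - 1) * Var[X 0; P] := by
    rw [sampleVariance_eq _ m hn0, hZ, hWv]
    field_simp
    ring
  have c1 : (n : ℝ) / ((n : ℝ) - 1) ≤ 2 := by rw [div_le_iff₀ hn1]; linarith
  have c2 : √(n : ℝ) / ((n : ℝ) - 1) ≤ 2 := by rw [div_le_iff₀ hn1]; nlinarith
  have c1' : 0 ≤ (n : ℝ) / ((n : ℝ) - 1) := by positivity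
  have c2' : 0 ≤ √(n : ℝ) / ((n : ℝ) - 1) := by positivity
  have hZ2 : 0 ≤ Z ^ 2 / √(n : ℝ) := by positivity
  rw [e]
  refine le_trans ?_ (le_abs_self _)
  refine (abs_add_le _ _).trans ?_
  rw [abs_mul, abs_mul, abs_of_nonneg c1', abs_of_nonneg c2', abs_of_nonneg hv]
  have h5 : |W - Z ^ 2 / √(n : ℝ)| ≤ |W| + Z ^ 2 / √(n : ℝ) :=
    (abs_sub _ _).trans (by rw [abs_of_nonneg hZ2])
  have h6 := mul_le_mul c1 h5 (abs_nonneg _) zero_le_two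
  have h7 := mul_le_mul_of_nonneg_right c2 hv
  linarith

lemma eventuallySqUnifIntegrable_locScaleQuantile (hindep : iIndepFun X P)
    (hident : ∀ i, IdentDistrib (X i) (X 0) P P) (hL : MemLp (X 0) 4 P) (hσ : 0 < Var[X 0; P])
    (q : ℝ) :
    EventuallySqUnifIntegrable (fun (n : ℕ) ω =>
      √(n : ℝ) * (locScaleQuantile q n (fun j => X j ω) - (P[X 0] + stdDev (X 0) P * q))) P := by
  have h1 := eventuallySqUnifIntegrable_sampleMean hindep hident (hL.mono_exponent (by norm_num))
  have h2 := (eventuallySqUnifIntegrable_sampleVariance hindep hident hL).comp_linear_growth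
    (aemeasurable_sampleVariance fun i => (hident i).aemeasurable_fst)
    Real.continuous_sqrt.measurable (Real.hasDerivAt_sqrt hσ.ne') (C := 1) fun x => by
      rw [abs_of_nonneg (Real.sqrt_nonneg x), one_mul, Real.sqrt_le_iff]
      exact ⟨by positivity, by nlinarith [le_abs_self x, abs_nonneg x]⟩
  convert h1.add (h2.const_mul q) using 3
  simp only [locScaleQuantile, stdDev]
  ring

/-- Since `|x - m|` is 1-Lipschitz in `m`, replacing the mean by the sample mean changes the mean
absolute deviation by at most the error of the sample mean. No regularity of the law is needed. -/
lemma eventuallySqUnifIntegrable_sampleMAD (hindep : iIndepFun X P)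
    (hident : ∀ i, IdentDistrib (X i) (X 0) P P) (hL : MemLp (X 0) 2 P) :
    EventuallySqUnifIntegrable (fun (n : ℕ) ω =>
      √(n : ℝ) * (sampleMAD n (fun j => X j ω) - ∫ ω', |X 0 ω' - P[X 0]| ∂P)) P := by
  set m := P[X 0] with hm
  have hX : ∀ i, AEMeasurable (X i) P := fun i => (hident i).aemeasurable_fst
  have hg : Measurable fun x : ℝ => |x - m| := by fun_prop
  have hgL : MemLp (fun ω => |X 0 ω - m|) 2 P := (hL.sub (memLp_const m)).norm
  have h1 := (eventuallySqUnifIntegrable_normalizedSum_comp hindep hident hg hgL).abs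
    fun n => (memLp_normalizedSum_comp hident hg hgL n).aestronglyMeasurable
  have h2 := (eventuallySqUnifIntegrable_sampleMean hindep hident hL).abs fun n =>
    (((aemeasurable_sampleMean hX n).sub_const _).const_mul _).aestronglyMeasurable
  refine (h1.add h2).of_eventually_le (fun n =>
    (((aemeasurable_sampleMAD hX n).sub_const _).const_mul _).aestronglyMeasurable) ?_
  filter_upwards [eventually_ne_atTop 0] with n hn ω
  have hn' : (0 : ℝ) < n := by exact_mod_cast Nat.pos_of_ne_zero hn
  refine le_trans ?_ (le_abs_self _)
  rw [← sqrt_mul_average_sub (fun x => |x - m|) hn ω, abs_mul, abs_mul, abs_mul, ← mul_add,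
    abs_of_nonneg (Real.sqrt_nonneg _)]
  gcongr
  have h3 : |sampleMAD n (fun j => X j ω) - (∑ j ∈ Finset.range n, |X j ω - m|) / n|
      ≤ |sampleMean n (fun j => X j ω) - m| := by
    rw [sampleMAD, ← sub_div, ← Finset.sum_sub_distrib, abs_div, abs_of_pos hn', div_le_iff₀ hn']
    refine (Finset.abs_sum_le_sum_abs _ _).trans ((Finset.sum_le_card_nsmul _ _
      (|sampleMean n (fun j => X j ω) - m|) fun j _ => ?_).trans (by simp [mul_comm]))
    refine (abs_abs_sub_abs_le _ _).trans (le_of_eq ?_)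
    rw [abs_sub_comm (sampleMean n fun j => X j ω)]
    congr 1
    ring
  have := abs_sub_le (sampleMAD n (fun j => X j ω)) ((∑ j ∈ Finset.range n, |X j ω - m|) / n)
    (∫ ω', |X 0 ω' - m| ∂P)
  linarith

end ErrorIntegrability

/-! ### The measure of dispersion of order `r` -/

section Dispersion

variable {Ω : Type*} [MeasurableSpace Ω] {P : Measure Ω} [IsProbabilityMeasure P] {X : ℕ → Ω → ℝ}

/-- Influence function of the measure of dispersion of order `r`, where `m` stands for the mean and
`c` for `2 F(m) - 1`. -/
def dispersionInfluence (r : ℕ) (m c x : ℝ) : ℝ :=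
  |x - m| ^ r + (2 - (r : ℝ)) * c * (x - m)

lemma isAsymptoticallyLinear_sampleDispersion (hindep : iIndepFun X P)
    (hident : ∀ i, IdentDistrib (X i) (X 0) P P) (hL : MemLp (X 0) 4 P) {r : ℕ}
    (hr : r = 1 ∨ r = 2) (hc : r = 1 → ContinuousAt (distFun (X 0) P) P[X 0]) :
    IsAsymptoticallyLinear X P (fun n ω => sampleDispersion r n (fun j => X j ω))
      (dispersion r (X 0) P)
      (dispersionInfluence r P[X 0] (2 * distFun (X 0) P P[X 0] - 1)) := by
  unfold dispersionInfluence
  rcases hr with rfl | rfl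
  · have := isAsymptoticallyLinear_sampleMAD hindep hident (hL.mono_exponent (by norm_num)) (hc rfl)
    norm_num [sampleDispersion, dispersion]
    exact this
  · have := isAsymptoticallyLinear_sampleVariance hindep hident hL
    norm_num [sampleDispersion, dispersion]
    exact this

lemma eventuallySqUnifIntegrable_sampleDispersion (hindep : iIndepFun X P)
    (hident : ∀ i, IdentDistrib (X i) (X 0) P P) (hL : MemLp (X 0) 4 P) (r : ℕ) :
    EventuallySqUnifIntegrable (fun (n : ℕ) ω =>
      √(n : ℝ) * (sampleDispersion r n (fun j => X j ω) - dispersion r (X 0) P)) P := by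
  unfold sampleDispersion dispersion
  split_ifs
  · exact eventuallySqUnifIntegrable_sampleVariance hindep hident hL
  · exact eventuallySqUnifIntegrable_sampleMAD hindep hident (hL.mono_exponent (by norm_num))

end Dispersion

/-! ### Quantiles and moments of the standardised variable -/

section Standardized

variable {Ω : Type*} [MeasurableSpace Ω] {P : Measure Ω} {X : Ω → ℝ}

lemma stdDev_pos (hσ : 0 < Var[X; P]) : 0 < stdDev X P := Real.sqrt_pos.2 hσ

lemma eq_add_stdDev_mul_standardized (hσ : 0 < Var[X; P]) (ω : Ω) :
    X ω = P[X] + stdDev X P * standardized X P ω := by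
  have := (stdDev_pos hσ).ne'
  simp only [standardized]
  field_simp
  ring

lemma integral_standardized_sq (hL : MemLp X 4 P) (hσ : 0 < Var[X; P]) :
    ∫ ω, standardized X P ω ^ 2 ∂P = 1 := by
  simp only [standardized, div_pow]
  rw [integral_div, ← variance_eq_integral hL.aemeasurable, stdDev, Real.sq_sqrt hσ.le,
    div_self hσ.ne']

variable [IsProbabilityMeasure P]

lemma distFun_standardized (hX : AEMeasurable X P) (hσ : 0 < Var[X; P]) (y : ℝ) :
    distFun (standardized X P) P y = distFun X P (P[X] + stdDev X P * y) := by
  have hs := stdDev_pos hσ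
  have hY : AEMeasurable (standardized X P) P := (hX.sub_const _).div_const _
  rw [distFun_eq_real hY, distFun_eq_real hX, map_measureReal_apply_of_aemeasurable hY measurableSet_Iic,
    map_measureReal_apply_of_aemeasurable hX measurableSet_Iic]
  congr 1
  ext ω
  simp only [Set.mem_preimage, Set.mem_Iic, standardized]
  rw [div_le_iff₀ hs, sub_le_iff_le_add']
  rw [mul_comm]

/-- Quantiles are equivariant under the affine map that undoes the standardisation. -/
lemma quantile_eq_add_stdDev_mul (hX : AEMeasurable X P) (hσ : 0 < Var[X; P]) {p : ℝ}
    (hp : p ∈ Set.Ioo (0 : ℝ) 1) :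
    quantile X P p = P[X] + stdDev X P * quantile (standardized X P) P p := by
  have hs := stdDev_pos hσ
  have hY : AEMeasurable (standardized X P) P := (hX.sub_const _).div_const _
  have := Measure.isProbabilityMeasure_map hY
  set S : Set ℝ := {y | p ≤ distFun (standardized X P) P y} with hS
  have hne : S.Nonempty := by
    have h1 : Tendsto (distFun (standardized X P) P) atTop (𝓝 1) := tendsto_cdf_atTop _
    obtain ⟨y, hy⟩ := (h1.eventually_const_lt hp.2).exists
    exact ⟨y, le_of_lt hy⟩
  have hbdd : BddBelow S := by
    have h1 : Tendsto (distFun (standardized X P) P) atBot (𝓝 0) := tendsto_cdf_atBot _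
    obtain ⟨b, hb⟩ := (h1.eventually_lt_const hp.1).exists
    refine ⟨b, fun y hy => ?_⟩
    by_contra! hc
    have : distFun (standardized X P) P y ≤ distFun (standardized X P) P b :=
      monotone_cdf _ hc.le
    exact absurd (hy.trans this) (not_le.2 hb)
  have himg : {x : ℝ | p ≤ distFun X P x} = (fun y => P[X] + stdDev X P * y) '' S := by
    ext x
    simp only [Set.mem_ofPred_eq, Set.mem_image, hS, distFun_standardized hX hσ]
    constructor
    · intro hx
      refine ⟨(x - P[X]) / stdDev X P, ?_, ?_⟩
      · rwa [mul_div_cancel₀ _ hs.ne', add_sub_cancel]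
      · rw [mul_div_cancel₀ _ hs.ne', add_sub_cancel]
    · rintro ⟨y, hy, rfl⟩
      exact hy
  have hmono : Monotone fun y => P[X] + stdDev X P * y := fun a b hab => by
    simp only
    gcongr
  unfold quantile
  rw [himg]
  exact (hmono.map_csInf_of_continuousAt (by fun_prop) hne hbdd).symm

lemma memLp_standardized (hL : MemLp X 4 P) : MemLp (standardized X P) 4 P := by
  have : standardized X P = fun ω => (stdDev X P)⁻¹ * (X ω - P[X]) := by
    ext ω
    rw [standardized, div_eq_inv_mul]
  rw [this]
  exact (hL.sub (memLp_const _)).const_mul _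

lemma integral_standardized (hL : MemLp X 4 P) : ∫ ω, standardized X P ω ∂P = 0 := by
  simp only [standardized]
  rw [integral_div, integral_sub (hL.integrable (by norm_num)) (integrable_const _)]
  simp

end Standardized

section StandardMoments

variable {Ω : Type*} [MeasurableSpace Ω] {P : Measure Ω} {Y : Ω → ℝ}

/-- The two expressions for `E[Y |Y|^r]`. -/
lemma integral_mul_abs_pow (hY : MemLp Y 4 P) [IsProbabilityMeasure P] {r : ℕ}
    (hr : r = 1 ∨ r = 2) :
    ∫ ω, Y ω * |Y ω| ^ r ∂P = (∫ ω, Y ω ^ (r + 1) ∂P) - (2 - (r : ℝ)) *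
      (2 * ∫ ω, (Set.Iio (0 : ℝ)).indicator (fun y => |y| ^ (r + 1)) (Y ω) ∂P) := by
  rcases hr with rfl | rfl
  · have hsq : Integrable (fun ω => Y ω ^ 2) P := (hY.mono_exponent (by norm_num)).integrable_sq
    have hm : Measurable ((Set.Iio (0 : ℝ)).indicator fun y : ℝ => |y| ^ 2) :=
      Measurable.indicator (by fun_prop) measurableSet_Iio
    have hi : Integrable (fun ω => (Set.Iio (0 : ℝ)).indicator (fun y => |y| ^ 2) (Y ω)) P := by
      refine hsq.mono' (hm.comp_aemeasurable hY.aemeasurable).aestronglyMeasurable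
        (ae_of_all _ fun ω => ?_)
      by_cases h : Y ω ∈ Set.Iio (0 : ℝ)
      · simp [Set.indicator_of_mem h]
      · simp [Set.indicator_of_notMem h, sq_nonneg]
    have e : ∀ ω, Y ω * |Y ω| ^ 1
        = Y ω ^ 2 - 2 * (Set.Iio (0 : ℝ)).indicator (fun y => |y| ^ 2) (Y ω) := by
      intro ω
      by_cases h : Y ω ∈ Set.Iio (0 : ℝ)
      · rw [Set.indicator_of_mem h, abs_of_neg h]
        ring
      · rw [Set.indicator_of_notMem h, abs_of_nonneg (not_lt.1 h)]
        ring
    simp_rw [e]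
    rw [integral_sub hsq (hi.const_mul 2), integral_const_mul]
    norm_num
  · simp only [Nat.cast_ofNat, sub_self, zero_mul, sub_zero, sq_abs]
    congr 1 with ω
    ring

variable [IsProbabilityMeasure P]

lemma memLp_two_abs_pow (hY : MemLp Y 4 P) {r : ℕ} (hr : r = 1 ∨ r = 2) :
    MemLp (fun ω => |Y ω| ^ r) 2 P := by
  rcases hr with rfl | rfl
  · simpa using (hY.mono_exponent (p := 2) (by norm_num)).norm
  · simpa using hY.sq_of_four

/-- The variance of the standardised quantile influence function. -/
lemma variance_add_mul_sq (hY : MemLp Y 4 P) (h1 : ∫ ω, Y ω ∂P = 0) (h2 : ∫ ω, Y ω ^ 2 ∂P = 1)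
    (b : ℝ) :
    Var[fun ω => 1 * Y ω + b * Y ω ^ 2; P]
      = 1 + 2 * b * ∫ ω, Y ω ^ 3 ∂P + b ^ 2 * ((∫ ω, Y ω ^ 4 ∂P) - 1) := by
  have hL : MemLp Y 2 P := hY.mono_exponent (by norm_num)
  rw [variance_linear_combination hL hY.sq_of_four, variance_eq_sub hL, covariance_eq_sub hL
    hY.sq_of_four, variance_eq_sub hY.sq_of_four]
  have e3 : P[Y * fun ω => Y ω ^ 2] = ∫ ω, Y ω ^ 3 ∂P := by
    congr 1 with ω; simp only [Pi.mul_apply]; ring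
  have e4 : P[(fun ω => Y ω ^ 2) ^ 2] = ∫ ω, Y ω ^ 4 ∂P := by
    congr 1 with ω; simp only [Pi.pow_apply]; ring
  have e2 : P[Y ^ 2] = 1 := h2
  rw [e3, e4, e2, h1, h2]
  ring

/-- The covariance of the two standardised influence functions. -/
lemma covariance_add_mul_sq_abs_pow (hY : MemLp Y 4 P) (h1 : ∫ ω, Y ω ∂P = 0)
    (h2 : ∫ ω, Y ω ^ 2 ∂P = 1) {r : ℕ} (hr : r = 1 ∨ r = 2) (b e : ℝ) :
    cov[fun ω => 1 * Y ω + b * Y ω ^ 2, fun ω => |Y ω| ^ r + e * Y ω; P]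
      = (∫ ω, Y ω * |Y ω| ^ r ∂P) + e + b * ((∫ ω, |Y ω| ^ (r + 2) ∂P) - (∫ ω, |Y ω| ^ r ∂P)
        + e * ∫ ω, Y ω ^ 3 ∂P) := by
  have hL : MemLp Y 2 P := hY.mono_exponent (by norm_num)
  have hr2 := memLp_two_abs_pow hY hr
  have hsq := hY.sq_of_four
  have c1 : cov[Y, fun ω => |Y ω| ^ r; P] = ∫ ω, Y ω * |Y ω| ^ r ∂P := by
    rw [covariance_eq_sub hL hr2, h1, zero_mul, sub_zero]; rfl
  have c2 : cov[Y, Y; P] = 1 := by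
    rw [covariance_self hL.aemeasurable, variance_eq_sub hL, h1]
    simpa using h2
  have c3 : cov[fun ω => Y ω ^ 2, fun ω => |Y ω| ^ r; P]
      = (∫ ω, |Y ω| ^ (r + 2) ∂P) - ∫ ω, |Y ω| ^ r ∂P := by
    rw [covariance_eq_sub hsq hr2, h2, one_mul]
    congr 2 with ω
    simp only [Pi.mul_apply]
    rw [pow_add, sq_abs, mul_comm]
  have c4 : cov[fun ω => Y ω ^ 2, Y; P] = ∫ ω, Y ω ^ 3 ∂P := by
    rw [covariance_eq_sub hsq hL, h1, mul_zero, sub_zero]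
    congr 1 with ω
  have hl1 : MemLp (fun ω => 1 * Y ω) 2 P := hL.const_mul 1
  have hl2 : MemLp (fun ω => b * Y ω ^ 2) 2 P := hsq.const_mul b
  have hl3 : MemLp (fun ω => e * Y ω) 2 P := hL.const_mul e
  change cov[(fun ω => 1 * Y ω) + fun ω => b * Y ω ^ 2, (fun ω => |Y ω| ^ r) + fun ω => e * Y ω; P]
    = _
  rw [covariance_add_left hl1 hl2 (hr2.add hl3), covariance_add_right hl1 hr2 hl3,
    covariance_add_right hl2 hr2 hl3]
  simp only [covariance_const_mul_left, covariance_const_mul_right, c1, c2, c3, c4]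
  ring

end StandardMoments

/-! ### The asymptotic covariance matrix -/

section CovarianceMatrix

variable {Ω : Type*} [MeasurableSpace Ω] {P : Measure Ω} {X : Ω → ℝ}

lemma quantileInfluence_eq (hσ : 0 < Var[X; P]) (q : ℝ) (ω : Ω) :
    quantileInfluence q P[X] (stdDev X P) (X ω) = P[X] + stdDev X P *
      (1 * standardized X P ω + q / 2 * standardized X P ω ^ 2) := by
  have := (stdDev_pos hσ).ne'
  rw [quantileInfluence, eq_add_stdDev_mul_standardized hσ ω]
  field_simp
  ring

lemma dispersionInfluence_eq (hσ : 0 < Var[X; P]) {r : ℕ} (hr : r = 1 ∨ r = 2) (c : ℝ) (ω : Ω) :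
    dispersionInfluence r P[X] c (X ω) = stdDev X P ^ r *
      (|standardized X P ω| ^ r + (2 - (r : ℝ)) * c * standardized X P ω) := by
  have := stdDev_pos hσ
  have e : X ω - P[X] = stdDev X P * standardized X P ω := by
    rw [eq_add_stdDev_mul_standardized hσ ω]; ring
  rw [dispersionInfluence, e, abs_mul, abs_of_pos this, mul_pow]
  rcases hr with rfl | rfl
  · ring
  · norm_num

variable [IsProbabilityMeasure P]

lemma variance_quantileInfluence (hL : MemLp X 4 P) (hσ : 0 < Var[X; P]) (p : ℝ) :
    Var[fun ω => quantileInfluence (quantile (standardized X P) P p) P[X] (stdDev X P) (X ω); P]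
      = stdDev X P ^ 2 * quantileVarFactor p (standardized X P) P := by
  have hY := memLp_standardized hL
  simp_rw [quantileInfluence_eq hσ]
  rw [variance_const_add, variance_const_mul, variance_add_mul_sq hY (integral_standardized hL)
    (integral_standardized_sq hL hσ), quantileVarFactor]
  · ring
  · exact ((((hY.mono_exponent (p := 2) (by norm_num)).const_mul 1).add
      (hY.sq_of_four.const_mul _)).const_mul _).aestronglyMeasurable

lemma distFun_standardized_zero (hL : MemLp X 4 P) (hσ : 0 < Var[X; P]) :
    distFun (standardized X P) P 0 = distFun X P P[X] := by
  rw [distFun_standardized hL.aemeasurable hσ, mul_zero, add_zero]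

lemma covariance_influence (hL : MemLp X 4 P) (hσ : 0 < Var[X; P]) (p : ℝ) {r : ℕ}
    (hr : r = 1 ∨ r = 2) :
    cov[fun ω => quantileInfluence (quantile (standardized X P) P p) P[X] (stdDev X P) (X ω),
      fun ω => dispersionInfluence r P[X] (2 * distFun X P P[X] - 1) (X ω); P]
      = stdDev X P ^ (r + 1) * crossFactor r p (standardized X P) P := by
  have hY := memLp_standardized hL
  simp_rw [quantileInfluence_eq hσ, dispersionInfluence_eq hσ hr]
  rw [covariance_const_add_left, covariance_const_mul_left, covariance_const_mul_right,
    covariance_add_mul_sq_abs_pow hY (integral_standardized hL) (integral_standardized_sq hL hσ) hr,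
    crossFactor, integral_mul_abs_pow hY hr, distFun_standardized_zero hL hσ]
  · ring
  · exact ((((hY.mono_exponent (p := 2) (by norm_num)).const_mul 1).add
      (hY.sq_of_four.const_mul _)).const_mul _).integrable one_le_two

lemma dispersionVar_standardized (hL : MemLp X 4 P) (hσ : 0 < Var[X; P]) {r : ℕ}
    (hr : r = 1 ∨ r = 2) :
    Var[fun ω => dispersionInfluence r P[X] (2 * distFun X P P[X] - 1) (X ω); P]
      = (stdDev X P ^ r) ^ 2 * dispersionVar r 0 (standardized X P) P := by
  simp_rw [dispersionInfluence_eq hσ hr]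
  rw [variance_const_mul, dispersionVar, distFun_standardized_zero hL hσ]
  simp only [sub_zero]

lemma dispersionVar_eq_variance_influence (hL : MemLp X 4 P) {r : ℕ} (hr : r = 1 ∨ r = 2) :
    dispersionVar r P[X] X P
      = Var[fun ω => dispersionInfluence r P[X] (2 * distFun X P P[X] - 1) (X ω); P] := by
  have hLm : MemLp (fun ω => X ω - P[X]) 4 P := hL.sub (memLp_const _)
  unfold dispersionVar dispersionInfluence
  have e : ∀ ω, |X ω - P[X]| ^ r + (2 - (r : ℝ)) * (2 * distFun X P P[X] - 1) * X ω
      = (|X ω - P[X]| ^ r + (2 - (r : ℝ)) * (2 * distFun X P P[X] - 1) * (X ω - P[X]))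
        + (2 - (r : ℝ)) * (2 * distFun X P P[X] - 1) * P[X] := fun ω => by ring
  simp_rw [e]
  exact variance_add_const ((memLp_two_abs_pow hLm hr).add
    ((hLm.mono_exponent (p := 2) (by norm_num)).const_mul _)).aestronglyMeasurable _

/-- The asymptotic covariance matrix is the covariance matrix of the influence functions of the
two transformed estimators. -/
theorem covMatrix_influence_eq (hL : MemLp X 4 P) (hσ : 0 < Var[X; P]) (p : ℝ) {r : ℕ}
    (hr : r = 1 ∨ r = 2) (d₁ d₂ : ℝ) :
    covMatrix (fun ω => d₁ * quantileInfluence (quantile (standardized X P) P p) P[X]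
        (stdDev X P) (X ω))
      (fun ω => d₂ * dispersionInfluence r P[X] (2 * distFun X P P[X] - 1) (X ω)) P
      = asympCovMatrix r p d₁ d₂ X P := by
  rw [covMatrix, asympCovMatrix, variance_const_mul, variance_const_mul, covariance_const_mul_left,
    covariance_const_mul_right, variance_quantileInfluence hL hσ, covariance_influence hL hσ p hr,
    ← dispersionVar_eq_variance_influence hL hr]
  congr! 3 <;> ring_nf

/-- The correlation coefficient read off from the asymptotic covariance matrix. -/
theorem asympCovMatrix_correlation (hL : MemLp X 4 P) (hσ : 0 < Var[X; P]) (p : ℝ) {r : ℕ}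
    (hr : r = 1 ∨ r = 2) {d₁ d₂ : ℝ} (h0 : 0 < asympCovMatrix r p d₁ d₂ X P 0 0)
    (h1 : 0 < asympCovMatrix r p d₁ d₂ X P 1 1) :
    asympCovMatrix r p d₁ d₂ X P 0 1 /
        √(asympCovMatrix r p d₁ d₂ X P 0 0 * asympCovMatrix r p d₁ d₂ X P 1 1)
      = Real.sign (d₁ * d₂) * asympCorrelation r p X P := by
  have hs := stdDev_pos hσ
  simp only [asympCovMatrix, Matrix.of_apply, Matrix.cons_val', Matrix.cons_val_zero,
    Matrix.cons_val_one, Matrix.cons_val_fin_one, asympCorrelation] at *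
  rw [dispersionVar_eq_variance_influence hL hr, dispersionVar_standardized hL hσ hr] at *
  set A := quantileVarFactor p (standardized X P) P
  set V := dispersionVar r 0 (standardized X P) P
  set B := crossFactor r p (standardized X P) P
  set s := stdDev X P
  have hd1 : d₁ ≠ 0 := by rintro rfl; simp at h0
  have hd2 : d₂ ≠ 0 := by rintro rfl; simp at h1
  have hd : 0 < |d₁ * d₂| := abs_pos.2 (mul_ne_zero hd1 hd2)
  have e : s ^ 2 * d₁ ^ 2 * A * (d₂ ^ 2 * ((s ^ r) ^ 2 * V))
      = (s ^ (r + 1) * |d₁ * d₂|) ^ 2 * (A * V) := by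
    rw [mul_pow, sq_abs]
    ring
  rw [e, Real.sqrt_mul (sq_nonneg _), Real.sqrt_sq (by positivity)]
  have hsign : d₁ * d₂ = Real.sign (d₁ * d₂) * |d₁ * d₂| := by
    rcases lt_or_gt_of_ne (mul_ne_zero hd1 hd2) with h | h
    · rw [Real.sign_of_neg h, abs_of_neg h]; ring
    · rw [Real.sign_of_pos h, abs_of_pos h]; ring
  rw [mul_assoc (s ^ (r + 1)) d₁ d₂]
  nth_rewrite 1 [hsign]
  have hsr : s ^ (r + 1) ≠ 0 := by positivity
  field_simp

end CovarianceMatrix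

/-! ### Correlations and the limit theorem -/

section Correlation

variable {Ω : Type*} [MeasurableSpace Ω] {P : Measure Ω} [IsProbabilityMeasure P]

lemma correlation_const_mul_sub {U V : Ω → ℝ} (hU : Integrable U P) (hV : Integrable V P) {a : ℝ}
    (ha : a ≠ 0) (u v : ℝ) :
    correlation (fun ω => a * (U ω - u)) (fun ω => a * (V ω - v)) P = correlation U V P := by
  unfold correlation
  rw [covariance_const_mul_left, covariance_const_mul_right, covariance_sub_const_left hU,
    covariance_sub_const_right hV, variance_const_mul, variance_const_mul,
    variance_sub_const hU.aestronglyMeasurable, variance_sub_const hV.aestronglyMeasurable,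
    show a ^ 2 * Var[U; P] * (a ^ 2 * Var[V; P]) = (a ^ 2) ^ 2 * (Var[U; P] * Var[V; P]) by ring,
    Real.sqrt_mul (sq_nonneg _), Real.sqrt_sq (sq_nonneg a), ← mul_assoc, ← sq]
  exact mul_div_mul_left _ _ (pow_ne_zero 2 ha)

/-- If the normalised errors of two estimators converge jointly to a centred Gaussian law and have
uniformly integrable squares, then the correlation of the estimators converges to the correlation
of the limit law. -/
theorem tendsto_correlation_of_tendstoInDistribution {U V : ℕ → Ω → ℝ} {u v : ℝ}
    {S : Matrix (Fin 2) (Fin 2) ℝ} (hS : S.PosSemidef) (h0 : 0 < S 0 0) (h1 : 0 < S 1 1)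
    (h : TendstoInDistribution
      (fun (n : ℕ) (ω : Ω) => !₂[√(n : ℝ) * (U n ω - u), √(n : ℝ) * (V n ω - v)])
      atTop (id : EuclideanSpace ℝ (Fin 2) → EuclideanSpace ℝ (Fin 2)) (fun _ => P)
      (multivariateGaussian 0 S))
    (hU : EventuallySqUnifIntegrable (fun (n : ℕ) ω => √(n : ℝ) * (U n ω - u)) P)
    (hV : EventuallySqUnifIntegrable (fun (n : ℕ) ω => √(n : ℝ) * (V n ω - v)) P) :
    Tendsto (fun n => correlation (U n) (V n) P) atTop (𝓝 (S 0 1 / √(S 0 0 * S 1 1))) := by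
  have hz : ∀ i : Fin 2, Continuous fun z : EuclideanSpace ℝ (Fin 2) => z i := fun i => by fun_prop
  have hzL : ∀ i : Fin 2, MemLp (fun z : EuclideanSpace ℝ (Fin 2) => z i) 2
      (multivariateGaussian 0 S) := fun i =>
    (EuclideanSpace.proj (𝕜 := ℝ) i).comp_memLp' IsGaussian.memLp_two_id
  have c01 := tendsto_covariance_of_tendstoInDistribution h (hz 0) (hz 1) hU hV (hzL 0) (hzL 1)
  have c00 := tendsto_covariance_of_tendstoInDistribution h (hz 0) (hz 0) hU hU (hzL 0) (hzL 0)
  have c11 := tendsto_covariance_of_tendstoInDistribution h (hz 1) (hz 1) hV hV (hzL 1) (hzL 1)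
  simp only [id_eq, covariance_eval_multivariateGaussian hS] at c01 c00 c11
  have hlim := c01.div (c00.mul c11).sqrt (Real.sqrt_pos.2 (mul_pos h0 h1)).ne'
  refine hlim.congr' ?_
  filter_upwards [hU.eventually_memLp, hV.eventually_memLp, eventually_ne_atTop 0] with n hUn hVn hn
  have hs : √(n : ℝ) ≠ 0 := (Real.sqrt_pos.2 (by exact_mod_cast Nat.pos_of_ne_zero hn)).ne'
  have key : ∀ {W : Ω → ℝ} {w : ℝ}, MemLp (fun ω => √(n : ℝ) * (W ω - w)) 2 P → Integrable W P := by
    intro W w hW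
    refine (((hW.integrable one_le_two).const_mul (√(n : ℝ))⁻¹).add (integrable_const w)).congr
      (ae_of_all _ fun ω => ?_)
    simp only [Pi.add_apply]
    field_simp
    ring
  rw [← correlation_const_mul_sub (key hUn) (key hVn) hs u v, correlation,
    ← covariance_self hUn.aemeasurable, ← covariance_self hVn.aemeasurable]
  rfl

lemma correlation_multivariateGaussian {S : Matrix (Fin 2) (Fin 2) ℝ} (hS : S.PosSemidef) :
    correlation (fun z : EuclideanSpace ℝ (Fin 2) => z 0) (fun z => z 1) (multivariateGaussian 0 S)
      = S 0 1 / √(S 0 0 * S 1 1) := by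
  rw [correlation, covariance_eval_multivariateGaussian hS, variance_eval_multivariateGaussian hS,
    variance_eval_multivariateGaussian hS]

end Correlation

theorem mainTheorem3 {Ω : Type*} [MeasurableSpace Ω] (P : Measure Ω) [IsProbabilityMeasure P]
    (X : ℕ → Ω → ℝ) (hindep : iIndepFun X P) (hident : ∀ i, IdentDistrib (X i) (X 0) P P)
    (hM2 : Integrable (fun ω => X 0 ω ^ 4) P) (hσ : 0 < Var[X 0; P])
    (p : ℝ) (hp : p ∈ Set.Ioo (0 : ℝ) 1) (r : ℕ) (hr : r = 1 ∨ r = 2)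
    (hC0 : r = 1 → ContinuousAt (distFun (X 0) P) P[X 0])
    (h₁ h₂ : ℝ → ℝ) (hh₁ : Measurable h₁) (hh₂ : Measurable h₂) (d₁ d₂ : ℝ)
    (hd₁ : HasDerivAt h₁ d₁ (quantile (X 0) P p))
    (hd₂ : HasDerivAt h₂ d₂ (dispersion r (X 0) P)) :
    (asympCovMatrix r p d₁ d₂ (X 0) P).PosSemidef ∧
    TendstoInDistribution
      (fun (n : ℕ) (ω : Ω) => !₂[quantileError h₁ p X P n ω, dispersionError h₂ r X P n ω])
      atTop (id : EuclideanSpace ℝ (Fin 2) → EuclideanSpace ℝ (Fin 2)) (fun _ => P)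
      (multivariateGaussian 0 (asympCovMatrix r p d₁ d₂ (X 0) P)) ∧
    (0 < asympCovMatrix r p d₁ d₂ (X 0) P 0 0 → 0 < asympCovMatrix r p d₁ d₂ (X 0) P 1 1 →
      correlation (fun z : EuclideanSpace ℝ (Fin 2) => z 0) (fun z => z 1)
          (multivariateGaussian 0 (asympCovMatrix r p d₁ d₂ (X 0) P))
        = Real.sign (d₁ * d₂) * asympCorrelation r p (X 0) P ∧
      (EventuallySqUnifIntegrable (quantileError h₁ p X P) P →
        EventuallySqUnifIntegrable (dispersionError h₂ r X P) P →
        Tendsto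
          (fun n : ℕ => correlation
            (fun ω => h₁ (locScaleQuantile (quantile (standardized (X 0) P) P p) n
              (fun j => X j ω)))
            (fun ω => h₂ (sampleDispersion r n (fun j => X j ω))) P)
          atTop (𝓝 (Real.sign (d₁ * d₂) * asympCorrelation r p (X 0) P)))) ∧
    ((∃ C : ℝ, ∀ x, |h₁ x| ≤ C * (1 + |x|)) →
      EventuallySqUnifIntegrable (quantileError h₁ p X P) P) ∧
    ((∃ C : ℝ, ∀ x, |h₂ x| ≤ C * (1 + |x|)) →
      EventuallySqUnifIntegrable (dispersionError h₂ r X P) P) := by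
  have hX : ∀ i, AEMeasurable (X i) P := fun i => (hident i).aemeasurable_fst
  have hL : MemLp (X 0) 4 P := by
    rw [← integrable_norm_rpow_iff (hX 0).aestronglyMeasurable (by norm_num) (by norm_num)]
    refine hM2.congr (ae_of_all _ fun ω => ?_)
    have : (X 0 ω) ^ 4 = |X 0 ω| ^ 4 := by
      rw [show (4 : ℕ) = 2 * 2 by norm_num, pow_mul, pow_mul, sq_abs]
    have h4 : (4 : ENNReal).toReal = ((4 : ℕ) : ℝ) := by simp
    simp only [h4, Real.rpow_natCast, Real.norm_eq_abs, this]
  set q := quantile (standardized (X 0) P) P p with hq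
  have hqX : quantile (X 0) P p = P[X 0] + stdDev (X 0) P * q :=
    quantile_eq_add_stdDev_mul (hX 0) hσ hp
  have hQ := isAsymptoticallyLinear_locScaleQuantile hindep hident hL hσ q
  have hQ' := eventuallySqUnifIntegrable_locScaleQuantile hindep hident hL hσ q
  -- from here on the errors are centred at the quantile of `X`, as in the statement
  rw [← hqX] at hQ hQ'
  have hD := isAsymptoticallyLinear_sampleDispersion hindep hident hL hr hC0
  have hD' := eventuallySqUnifIntegrable_sampleDispersion hindep hident hL r
  have h1 := hQ.delta_method hindep hident hh₁ hd₁
  have h2 := hD.delta_method hindep hident hh₂ hd₂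
  have hcov := covMatrix_influence_eq hL hσ p hr d₁ d₂
  have hdist := h1.tendstoInDistribution_pair hindep hident h2
  have hpsd := posSemidef_covMatrix h1.memLp h2.memLp
  rw [← hq] at hcov
  rw [hcov] at hdist hpsd
  refine ⟨hpsd, hdist, fun p0 p1 => ?_, ?_, ?_⟩
  · rw [← asympCovMatrix_correlation hL hσ p hr p0 p1]
    exact ⟨correlation_multivariateGaussian hpsd, fun u1 u2 =>
      tendsto_correlation_of_tendstoInDistribution hpsd p0 p1 hdist u1 u2⟩
  · rintro ⟨C, hC⟩
    exact hQ'.comp_linear_growth hQ.aemeasurable hh₁ hd₁ hC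
  · rintro ⟨C, hC⟩
    exact hD'.comp_linear_growth hD.aemeasurable hh₂ hd₂ hC
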